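/- Let $M\subseteq B(\mathcal H)$ be a semifinite von Neumann algebra on a separable Hilbert space (i.e. $M$ carries a faithful normal semifinite trace), and suppose that $M$ has a faithful normal state $\varphi$. Let $G$ be a locally compact second countable Hausdorff topological semigroup with a $\sigma$-finite Borel measure $m$ such that $m(uB)=m(B)=m(Bu)$ for all $u\in G$ and all Borel sets $B\subseteq G$. Let $(K_n)_{n\in\mathbb N}$ be measurable subsets of $G$ with $0<m(K_n)<\infty$ and $$\lim_{n\to\infty}\frac{m(K_n\,\Delta\,K_ng)}{m(K_n)}=0=\lim_{n\to\infty}\frac{m(K_n\,\Delta\,gK_n)}{m(K_n)}\qquad\text{for all }g\in G.$$ Let $\alpha=(\alpha_g)_{g\in G}$ be bounded linear maps $\alpha_g:M\to M$ which form an action ($\alpha_{gh}=\alpha_g\circ\alpha_h$ for all $g,h\in G$) or an anti-action ($\alpha_{gh}=\alpha_h\circ\alpha_g$ for all $g,h\in G$), such that each $\alpha_g$ is positive, normal (weak*-continuous) and contractive with $\alpha_g(1)\le 1$, and such that $g\mapsto\alpha_g(x)$ is weak*-continuous for every $x\in M$. Put $$A_n(x)=\frac1{m(K_n)}\int_{K_n}\alpha_g(x)\,dm(g)\qquad(x\in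 M),$$ where the integral is taken in the weak* sense. A positive $x\in M$ is called weakly wandering if $\|A_n(x)\|\to0$. A functional $\nu$ on $M$ is called $G$-invariant if $\nu\circ\alpha_g=\nu$ for all $g\in G$. For a positive $x\in M$ let $s(x)$ be the smallest projection $p\in M$ with $px=x$; for a normal state $\nu$ let $s(\nu)=1-p$, where $p$ is the least upper bound of the projections of $M$ on which $\nu$ vanishes. Let $e\in M$ be a non-zero projection. Then the following are equivalent. 1. There is a $G$-invariant normal state $\rho$ on $M$ with $s(\rho)=e$, and $s(\nu)\le e$ for every $G$-invariant normal state $\nu$ on $M$. 2. There is a weakly wandering operator $x_0\in M_+$ with $s(x_0)=1-e$, and $s(x)\le 1-e$ for every weakly wandering operator $x\in M_+$. -/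

import Mathlib

open scoped ComplexOrder ENNReal NNReal symmDiff InnerProductSpace
open MeasureTheory Filter Topology

noncomputable section

namespace NCErgodic

variable {H : Type*} [NormedAddCommGroup H] [InnerProductSpace ℂ H] [CompleteSpace H]

/-- The elements of a von Neumann algebra, with the operator norm, the adjoint and the usual order
of operators inherited from `H →L[ℂ] H`. -/
abbrev Elem (M : VonNeumannAlgebra H) : Type _ := M.toStarSubalgebra

/-! ### Functionals -/

/-- A linear functional on `M` is normal if it is ultraweakly (`w`-) continuous, i.e. of the form
`x ↦ ∑ₙ ⟪ξₙ, x ηₙ⟫` with square summable sequences of vectors. These functionals form `M_*`. -/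
def IsNormal {M : VonNeumannAlgebra H} (φ : Elem M →ₗ[ℂ] ℂ) : Prop :=
  ∃ ξ η : ℕ → H, Summable (fun n => ‖ξ n‖ ^ 2) ∧ Summable (fun n => ‖η n‖ ^ 2) ∧
    ∀ x : Elem M, φ x = ∑' n, ⟪ξ n, (x : H →L[ℂ] H) (η n)⟫_ℂ

structure IsState {M : VonNeumannAlgebra H} (φ : Elem M →ₗ[ℂ] ℂ) : Prop where
  nonneg : ∀ x : Elem M, 0 ≤ φ (star x * x)
  map_one : φ 1 = 1

structure IsNormalState {M : VonNeumannAlgebra H} (φ : Elem M →ₗ[ℂ] ℂ) : Prop extends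
  IsState φ where
  normal : IsNormal φ

def IsFaithful {M : VonNeumannAlgebra H} (φ : Elem M →ₗ[ℂ] ℂ) : Prop :=
  ∀ x : Elem M, 0 ≤ x → φ x = 0 → x = 0

/-! ### Semifiniteness -/

/-- `τ` is a faithful normal semifinite trace on `M₊`; its values off `M₊` are irrelevant. -/
structure IsFNSTrace {M : VonNeumannAlgebra H} (τ : Elem M → ℝ≥0∞) : Prop where
  map_add : ∀ x y : Elem M, 0 ≤ x → 0 ≤ y → τ (x + y) = τ x + τ y
  map_smul : ∀ (c : ℝ≥0) (x : Elem M), 0 ≤ x → τ (((c : ℝ) : ℂ) • x) = c * τ x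
  tracial : ∀ x : Elem M, τ (star x * x) = τ (x * star x)
  faithful : ∀ x : Elem M, 0 ≤ x → τ x = 0 → x = 0
  normal : ∀ (D : Set (Elem M)) (x : Elem M), D.Nonempty → DirectedOn (· ≤ ·) D →
    (∀ d ∈ D, 0 ≤ d) → IsLUB D x → τ x = ⨆ d ∈ D, τ d
  semifinite : ∀ x : Elem M, 0 ≤ x → x ≠ 0 → ∃ y : Elem M, 0 ≤ y ∧ y ≤ x ∧ y ≠ 0 ∧ τ y < ∞

def IsSemifinite (M : VonNeumannAlgebra H) : Prop :=
  ∃ τ : Elem M → ℝ≥0∞, IsFNSTrace τ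

/-! ### Supports -/

lemma starProjection_mem (M : VonNeumannAlgebra H) (U : Submodule ℂ H)
    (hU : ∀ z ∈ M.commutant, ∀ v ∈ U, z v ∈ U.topologicalClosure) :
    U.topologicalClosure.starProjection ∈ M := by
  have : CompleteSpace U.topologicalClosure := U.isClosed_topologicalClosure.completeSpace_coe
  rw [VonNeumannAlgebra.IsStarProjection.mem_iff isStarProjection_starProjection]
  intro z hz
  rw [Submodule.range_starProjection, Module.End.mem_invtSubmodule]
  have h : U.topologicalClosure ≤ U.topologicalClosure.comap (z : H →ₗ[ℂ] H) := by
    refine Submodule.topologicalClosure_minimal _ (fun v hv => hU z hz v hv) ?_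
    exact U.isClosed_topologicalClosure.preimage z.continuous
  exact h

lemma starProjection_le_of (U : Submodule ℂ H) {p : H →L[ℂ] H} (hp : IsStarProjection p)
    (h : ∀ v ∈ U, p v = v) : U.topologicalClosure.starProjection ≤ p := by
  have : CompleteSpace U.topologicalClosure := U.isClosed_topologicalClosure.completeSpace_coe
  obtain ⟨V, hV, rfl⟩ := isStarProjection_iff_eq_starProjection.1 hp
  rw [Submodule.starProjection_le_starProjection_iff]
  refine Submodule.topologicalClosure_minimal _
    (fun v hv => Submodule.starProjection_eq_self_iff.1 (h v hv)) ?_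
  rw [← V.orthogonal_orthogonal]
  exact Vᗮ.isClosed_orthogonal

lemma isStarProjection_coe {M : VonNeumannAlgebra H} {p : Elem M} :
    IsStarProjection (p : H →L[ℂ] H) ↔ IsStarProjection p := by
  constructor
  · intro h
    exact ⟨Subtype.ext h.isIdempotentElem, Subtype.ext h.isSelfAdjoint⟩
  · intro h
    exact ⟨congrArg Subtype.val h.isIdempotentElem, congrArg Subtype.val h.isSelfAdjoint⟩

theorem exists_isLeast_support {M : VonNeumannAlgebra H} (x : Elem M) :
    ∃ s : Elem M, IsLeast {p : Elem M | IsStarProjection p ∧ p * x = x} s := by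
  let U : Submodule ℂ H := (x : H →L[ℂ] H).range
  have hmem : U.topologicalClosure.starProjection ∈ M := by
    refine starProjection_mem M U ?_
    rintro z hz _ ⟨w, rfl⟩
    refine U.le_topologicalClosure ⟨z w, ?_⟩
    have := VonNeumannAlgebra.mem_commutant_iff.1 hz x x.2
    exact DFunLike.congr_fun this w
  refine ⟨⟨_, hmem⟩, ⟨isStarProjection_coe.1 isStarProjection_starProjection, ?_⟩, ?_⟩
  · apply Subtype.ext
    ext w
    exact Submodule.starProjection_eq_self_iff.2 (U.le_topologicalClosure ⟨w, rfl⟩)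
  · rintro p ⟨hp, hpx⟩
    refine starProjection_le_of U (isStarProjection_coe.2 hp) ?_
    rintro _ ⟨w, rfl⟩
    exact DFunLike.congr_fun (congrArg Subtype.val hpx) w

/-- The support `s(x)` of a self-adjoint operator `x`: the smallest projection `p` of `M` with
`p x = x`. -/
def opSupport {M : VonNeumannAlgebra H} (x : Elem M) : Elem M :=
  (exists_isLeast_support x).choose

/-- The projections of `M`, ordered as operators. -/
abbrev Proj (M : VonNeumannAlgebra H) : Type _ := {p : Elem M // IsStarProjection p}

theorem exists_isLUB_proj {M : VonNeumannAlgebra H} (S : Set (Proj M)) :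
    ∃ p : Proj M, IsLUB S p := by
  let U : Submodule ℂ H := ⨆ q : S, (q.1.1 : H →L[ℂ] H).range
  have hmem : U.topologicalClosure.starProjection ∈ M := by
    refine starProjection_mem M U ?_
    intro z hz
    have h : U ≤ U.comap (z : H →ₗ[ℂ] H) := by
      refine iSup_le fun q => ?_
      rintro _ ⟨w, rfl⟩
      refine (le_iSup (fun q : S => (q.1.1 : H →L[ℂ] H).range) q) ⟨z w, ?_⟩
      exact DFunLike.congr_fun (VonNeumannAlgebra.mem_commutant_iff.1 hz q.1.1 q.1.1.2) w
    exact fun v hv => U.le_topologicalClosure (h hv)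
  refine ⟨⟨⟨_, hmem⟩, isStarProjection_coe.1 isStarProjection_starProjection⟩, ?_, ?_⟩
  · intro q hq
    obtain ⟨_, hV⟩ := isStarProjection_iff_eq_starProjection_range.1 (isStarProjection_coe.2 q.2)
    change (q.1 : H →L[ℂ] H) ≤ U.topologicalClosure.starProjection
    rw [hV, Submodule.starProjection_le_starProjection_iff]
    exact (le_iSup (fun q : S => (q.1.1 : H →L[ℂ] H).range) ⟨q, hq⟩).trans
      U.le_topologicalClosure
  · intro r hr
    refine starProjection_le_of U (isStarProjection_coe.2 r.2) ?_
    obtain ⟨V, _, hV⟩ := isStarProjection_iff_eq_starProjection.1 (isStarProjection_coe.2 r.2)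
    have hU : U ≤ V := by
      refine iSup_le fun q => ?_
      have h1 : (q.1.1 : H →L[ℂ] H) ≤ (r.1 : H →L[ℂ] H) := hr q.2
      obtain ⟨_, hW⟩ :=
        isStarProjection_iff_eq_starProjection_range.1 (isStarProjection_coe.2 q.1.2)
      rw [hW, hV, Submodule.starProjection_le_starProjection_iff] at h1
      exact h1
    intro v hv
    rw [hV]
    exact Submodule.starProjection_eq_self_iff.2 (hU hv)

/-- The support `s(φ)` of a positive normal functional: `1 - p`, where `p` is the least upper bound
of the projections on which `φ` vanishes. -/
def funSupport {M : VonNeumannAlgebra H} (φ : Elem M →ₗ[ℂ] ℂ) : Elem M :=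
  1 - ((exists_isLUB_proj {q : Proj M | φ q.1 = 0}).choose : Elem M)

/-! ### Dynamical systems and ergodic averages -/

/-- A non-commutative dynamical system: an action or an anti-action of the topological semigroup
`G` on `M` by positive normal contractions `α_g` with `α_g(1) ≤ 1`, such that every orbit map
`g ↦ α_g(x)` is continuous for the weak* topology `σ(M, M_*)`. -/
structure DynSystem (M : VonNeumannAlgebra H) (G : Type*) [Semigroup G] [TopologicalSpace G] where
  act : G → Elem M →L[ℂ] Elem M
  act_mul : (∀ g h, act (g * h) = (act g).comp (act h)) ∨
    (∀ g h, act (g * h) = (act h).comp (act g))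
  continuous_act : ∀ (x : Elem M) (φ : Elem M →ₗ[ℂ] ℂ), IsNormal φ →
    Continuous fun g => φ (act g x)
  norm_act_le : ∀ g, ‖act g‖ ≤ 1
  act_nonneg : ∀ g x, 0 ≤ x → 0 ≤ act g x
  act_one_le : ∀ g, act g 1 ≤ 1
  normal_act : ∀ (g : G) (φ : Elem M →ₗ[ℂ] ℂ), IsNormal φ →
    IsNormal (φ ∘ₗ (act g : Elem M →ₗ[ℂ] Elem M))

section Semigroup

variable {G : Type*} [Semigroup G]

/-- `m(uB) = m(B) = m(Bu)` for all Borel sets `B`; here `uB` and `Bu` are images, as translations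
of a semigroup need not be bijective. -/
def IsBiinvariant [MeasurableSpace G] (m : Measure G) : Prop :=
  ∀ (u : G) (B : Set G), MeasurableSet B →
    m ((fun g => u * g) '' B) = m B ∧ m ((fun g => g * u) '' B) = m B

/-- A two-sided Følner sequence of measurable sets. -/
structure IsFolnerSeq [MeasurableSpace G] (m : Measure G) (K : ℕ → Set G) : Prop where
  measurableSet : ∀ n, MeasurableSet (K n)
  pos : ∀ n, 0 < m (K n)
  lt_top : ∀ n, m (K n) < ∞
  right : ∀ g, Tendsto (fun n => m (K n ∆ ((fun h => h * g) '' K n)) / m (K n)) atTop (𝓝 0)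
  left : ∀ g, Tendsto (fun n => m (K n ∆ ((fun h => g * h) '' K n)) / m (K n)) atTop (𝓝 0)

variable [TopologicalSpace G] {M : VonNeumannAlgebra H}

/-- `φ` is `G`-invariant. -/
def IsInvariant (α : DynSystem M G) (φ : Elem M →ₗ[ℂ] ℂ) : Prop :=
  ∀ g x, φ (α.act g x) = φ x

lemma norm_act_apply_le (α : DynSystem M G) (g : G) (x : Elem M) : ‖α.act g x‖ ≤ ‖x‖ :=
  ((α.act g).le_of_opNorm_le (α.norm_act_le g) x).trans (by simp)

lemma norm_inner_act_le (α : DynSystem M G) (g : G) (x : Elem M) (ξ η : H) :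
    ‖⟪ξ, (α.act g x : H →L[ℂ] H) η⟫_ℂ‖ ≤ ‖ξ‖ * (‖x‖ * ‖η‖) := by
  refine (norm_inner_le_norm _ _).trans ?_
  gcongr
  exact ((α.act g x : H →L[ℂ] H).le_opNorm η).trans
    (mul_le_mul_of_nonneg_right (norm_act_apply_le α g x) (norm_nonneg _))

variable [MeasurableSpace G]

/-- `y` is the weak* integral `m(K)⁻¹ ∫_K α_g(x) dm(g)`. -/
def IsAverage (α : DynSystem M G) (m : Measure G) (K : Set G) (x y : Elem M) : Prop :=
  ∀ φ : Elem M →ₗ[ℂ] ℂ, IsNormal φ →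
    φ y = ((m K).toReal : ℂ)⁻¹ * ∫ g in K, φ (α.act g x) ∂m

/-- The vector functional `x ↦ ⟪ξ, x η⟫`. -/
def vecFun (M : VonNeumannAlgebra H) (ξ η : H) : Elem M →ₗ[ℂ] ℂ where
  toFun x := ⟪ξ, (x : H →L[ℂ] H) η⟫_ℂ
  map_add' x y := by simp
  map_smul' c x := by simp

lemma isNormal_vecFun (ξ η : H) : IsNormal (vecFun M ξ η) := by
  refine ⟨fun n => if n = 0 then ξ else 0, fun n => if n = 0 then η else 0, ?_, ?_, ?_⟩
  · exact summable_of_ne_finset_zero (s := {0}) (by intro n hn; simp_all)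
  · exact summable_of_ne_finset_zero (s := {0}) (by intro n hn; simp_all)
  · intro x
    rw [tsum_eq_single 0]
    · simp [vecFun]
    · intro n hn; simp [hn]

lemma IsAverage.unique {α : DynSystem M G} {m : Measure G} {K : Set G} {x y y' : Elem M}
    (h : IsAverage α m K x y) (h' : IsAverage α m K x y') : y = y' := by
  apply Subtype.ext
  ext v
  refine ext_inner_left ℂ fun w => ?_
  exact (h _ (isNormal_vecFun w v)).trans (h' _ (isNormal_vecFun w v)).symm

variable [BorelSpace G]

lemma integrableOn_inner (α : DynSystem M G) {m : Measure G} {K : Set G} (hK : m K ≠ ∞)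
    (x : Elem M) (ξ η : H) :
    IntegrableOn (fun g => ⟪ξ, (α.act g x : H →L[ℂ] H) η⟫_ℂ) K m := by
  refine Measure.integrableOn_of_bounded hK ?_ (ae_of_all _ fun g => norm_inner_act_le α g x ξ η)
  exact (α.continuous_act x _ (isNormal_vecFun ξ η)).aestronglyMeasurable

theorem exists_isAverage (α : DynSystem M G) (m : Measure G) (K : Set G) (x : Elem M) :
    ∃ y : Elem M, IsAverage α m K x y := by
  rcases eq_or_ne (m K) ∞ with hK | hK
  · exact ⟨0, fun φ _ => by simp [hK]⟩
  set c : ℂ := ((m K).toReal : ℂ)⁻¹ with hc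
  -- the bounded sesquilinear form `(v, w) ↦ c ∫ ⟪w, α_g(x) v⟫`
  let B : H →L⋆[ℂ] H →L[ℂ] ℂ := LinearMap.mkContinuous₂
    (LinearMap.mk₂'ₛₗ (starRingEnd ℂ) (RingHom.id ℂ)
      (fun v w => star (c * ∫ g in K, ⟪w, (α.act g x : H →L[ℂ] H) v⟫_ℂ ∂m))
      (by
        intro v v' w
        simp only [map_add, inner_add_right]
        rw [integral_add (integrableOn_inner α hK x w v) (integrableOn_inner α hK x w v')]
        simp [mul_add])
      (by
        intro a v w
        simp only [map_smul, inner_smul_right]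
        rw [integral_const_mul]
        simp; ring)
      (by
        intro v w w'
        simp only [inner_add_left]
        rw [integral_add (integrableOn_inner α hK x w v) (integrableOn_inner α hK x w' v)]
        simp [mul_add])
      (by
        intro a v w
        simp only [inner_smul_left]
        rw [integral_const_mul]
        simp; ring))
    (‖c‖ * (‖x‖ * (m K).toReal))
    (by
      intro v w
      simp only [LinearMap.mk₂'ₛₗ_apply, norm_star, norm_mul]
      have := norm_setIntegral_le_of_norm_le_const (μ := m) (s := K) (C := ‖w‖ * (‖x‖ * ‖v‖))
        (lt_top_iff_ne_top.2 hK) (fun g _ => norm_inner_act_le α g x w v)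
      calc _ ≤ ‖c‖ * (‖w‖ * (‖x‖ * ‖v‖) * (m K).toReal) := by gcongr; exact this
        _ = _ := by ring)
  let y : H →L[ℂ] H := InnerProductSpace.continuousLinearMapOfBilin B
  have hy : ∀ w v, ⟪w, y v⟫_ℂ = c * ∫ g in K, ⟪w, (α.act g x : H →L[ℂ] H) v⟫_ℂ ∂m := by
    intro w v
    rw [← inner_conj_symm, InnerProductSpace.continuousLinearMapOfBilin_apply]
    simp [B]
  have hmem : y ∈ M := by
    rw [← VonNeumannAlgebra.commutant_commutant M, VonNeumannAlgebra.mem_commutant_iff]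
    intro z hz
    ext v
    refine ext_inner_left ℂ fun w => ?_
    change ⟪w, z (y v)⟫_ℂ = ⟪w, y (z v)⟫_ℂ
    rw [← ContinuousLinearMap.adjoint_inner_left, hy, hy]
    congr 2
    ext g
    rw [ContinuousLinearMap.adjoint_inner_left]
    exact congrArg _
      (DFunLike.congr_fun (VonNeumannAlgebra.mem_commutant_iff.1 hz _ (α.act g x).2) v).symm
  refine ⟨⟨y, hmem⟩, ?_⟩
  rintro φ ⟨ξ, η, hξ, hη, hφ⟩
  have hsum : Summable fun n => ‖ξ n‖ * ‖η n‖ := by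
    refine Summable.of_nonneg_of_le (fun n => by positivity) (fun n => ?_) (hξ.add hη)
    nlinarith [sq_nonneg (‖ξ n‖ - ‖η n‖), sq_nonneg (‖ξ n‖), sq_nonneg (‖η n‖)]
  simp only [hφ, hy]
  rw [tsum_mul_left, ← integral_tsum_of_summable_integral_norm]
  · exact fun n => integrableOn_inner α hK x _ _
  · refine Summable.of_nonneg_of_le (fun n => integral_nonneg fun _ => norm_nonneg _)
      (fun n => ?_) (hsum.mul_left (‖x‖ * (m K).toReal))
    have := norm_setIntegral_le_of_norm_le_const (μ := m) (s := K)
      (f := fun g => ‖⟪ξ n, (α.act g x : H →L[ℂ] H) (η n)⟫_ℂ‖)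
      (C := ‖ξ n‖ * (‖x‖ * ‖η n‖)) (lt_top_iff_ne_top.2 hK)
      (fun g _ => by simpa using norm_inner_act_le α g x (ξ n) (η n))
    refine (le_abs_self _).trans (this.trans_eq ?_)
    simp only [Measure.real]
    ring

/-- The ergodic average `m(K)⁻¹ ∫_K α_g(x) dm(g)`, an element of `M`. -/
def average (α : DynSystem M G) (m : Measure G) (K : Set G) (x : Elem M) : Elem M :=
  (exists_isAverage α m K x).choose

/-- A weakly wandering operator: `x ≥ 0` and `‖A_n(x)‖ → 0`. -/
def IsWeaklyWandering (α : DynSystem M G) (m : Measure G) (K : ℕ → Set G) (x : Elem M) : Prop :=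
  0 ≤ x ∧ Tendsto (fun n => ‖average α m (K n) x‖) atTop (𝓝 0)

end Semigroup

end NCErgodic

end

open scoped ComplexOrder ENNReal NNReal symmDiff InnerProductSpace
open MeasureTheory Filter Topology

noncomputable section

namespace NCErgodic

/-! ### `M` as a C⋆-algebra with its intrinsic order. -/

section Order

variable {H : Type*} [NormedAddCommGroup H] [InnerProductSpace ℂ H] [CompleteSpace H]

/-! An invariant normal state `ν` satisfies `ν x = ν (A_n x)`, so it vanishes on every weakly
wandering operator; hence supports of invariant normal states are orthogonal to supports of weakly
wandering operators. The substance is a converse (`exists_weaklyWandering`): if all invariant normal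
states vanish on a projection `f` and a positive normal `φ` does not, then some weakly wandering `x
≤ f` has `φ x > 0`. Granting this, a faithful normal state and countable sums give a greatest
support on each side. The gap left below `e` or `1 - e` is a projection killed by all invariant
normal states and by all weakly wandering operators, so it is zero.

For the converse, suppose that no `x` with `0 ≤ x ≤ f` and `φ (f - x) ≤ δ` has averages eventually
of norm at most `β`. These `x` form a convex set, and Hahn-Banach together with the Følner condition
produces an invariant positive functional `ψ` that is at least `β` on it
(`exists_invariant_functional`). This `ψ` need not be normal. Its normal part, however, is invariant
(`isInvariant_normalProj`) and so vanishes on `f`; thus `ψ` is singular on the corner of `f`, and it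
is arbitrarily small on suitable `x ≤ f` that are `φ`-close to `f` (`exists_small_of_isInvariant`),
a contradiction. So there are `x_k` rapidly `φ`-close to `f` with averages eventually at most `2⁻ᵏ`.
The operator monotone function `a ↦ a (1 + a)⁻¹` applied to partial sums of `2ᵏ (f - x_k)` then
yields one operator that is almost below every `x_k`, hence weakly wandering.

Normal parts are obtained inside a representation. The vectors whose functional is normal form a
closed subspace that reduces the representation and is preserved by its commutant, and the
projection onto it splits off the normal part. The commutant Radon-Nikodym theorem
(`exists_commutant_of_le`) makes this part the largest normal functional below the given one. -/

lemma isClosed_vonNeumann (M : VonNeumannAlgebra H) :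
    IsClosed (M.toStarSubalgebra : Set (H →L[ℂ] H)) := by
  rw [VonNeumannAlgebra.coe_toStarSubalgebra, ← VonNeumannAlgebra.centralizer_centralizer M]
  exact Set.isClosed_centralizer _

scoped instance (M : VonNeumannAlgebra H) : CStarAlgebra (Elem M) :=
  StarSubalgebra.cstarAlgebra M.toStarSubalgebra (h_closed := isClosed_vonNeumann M)

lemma mem_of_commute {M : VonNeumannAlgebra H} {y : H →L[ℂ] H}
    (h : ∀ z ∈ M.commutant, z * y = y * z) : y ∈ M := by
  rw [← VonNeumannAlgebra.commutant_commutant M, VonNeumannAlgebra.mem_commutant_iff]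
  exact h

/-- The square root of `x` commutes with whatever commutes with `x`, so it lies in the double
commutant. Hence the order inherited from `H →L[ℂ] H` is the C⋆-order of `M`. -/
lemma elem_nonneg_iff_exists {M : VonNeumannAlgebra H} {x : Elem M} :
    0 ≤ x ↔ ∃ y : Elem M, x = star y * y := by
  constructor
  · intro hx
    have hx' : (0 : H →L[ℂ] H) ≤ x := hx
    have hmem : CFC.sqrt (x : H →L[ℂ] H) ∈ M := by
      refine mem_of_commute fun z hz => ?_
      have hc : Commute (x : H →L[ℂ] H) z :=
        VonNeumannAlgebra.mem_commutant_iff.1 hz x x.2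
      exact (hc.cfcₙ_nnreal  _).symm.eq
    refine ⟨⟨_, hmem⟩, Subtype.ext ?_⟩
    change (x : H →L[ℂ] H) = star (CFC.sqrt (x : H →L[ℂ] H)) * CFC.sqrt (x : H →L[ℂ] H)
    rw [(CFC.sqrt_nonneg (x : H →L[ℂ] H)).isSelfAdjoint.star_eq, CFC.sqrt_mul_sqrt_self _ hx']
  · rintro ⟨y, rfl⟩
    exact star_mul_self_nonneg (y : H →L[ℂ] H)

scoped instance (M : VonNeumannAlgebra H) : StarOrderedRing (Elem M) := by
  refine StarOrderedRing.of_nonneg_iff' ?_ ?_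
  · intro x y hxy z
    exact add_le_add_right (α := H →L[ℂ] H) hxy z
  · intro x
    exact elem_nonneg_iff_exists

end Order

/-! ### A Radon-Nikodym theorem in the commutant of a representation. -/

section RadonNikodym

variable {A : Type*} [CStarAlgebra A]
variable {K : Type*} [NormedAddCommGroup K] [InnerProductSpace ℂ K] [CompleteSpace K]

lemma inner_map_star (π : A →⋆ₐ[ℂ] (K →L[ℂ] K)) (a : A) (u v : K) :
    ⟪π (star a) u, v⟫_ℂ = ⟪u, π a v⟫_ℂ := by
  rw [map_star, ContinuousLinearMap.star_eq_adjoint, ContinuousLinearMap.adjoint_inner_left]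

lemma inner_map_star_mul_self (π : A →⋆ₐ[ℂ] (K →L[ℂ] K)) (a : A) (u : K) :
    ⟪u, π (star a * a) u⟫_ℂ = (‖π a u‖ ^ 2 : ℝ) := by
  rw [map_mul, mul_apply_eq_comp, ← inner_map_star, star_star,
    inner_self_eq_norm_sq_to_K]
  norm_cast

/-- The linear map `a ↦ π(a) v`. -/
def orbitMap (π : A →⋆ₐ[ℂ] (K →L[ℂ] K)) (v : K) : A →ₗ[ℂ] K where
  toFun a := π a v
  map_add' a b := by simp
  map_smul' c a := by simp

/-- The closed cyclic subspace generated by `v`. -/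
def cyclic (π : A →⋆ₐ[ℂ] (K →L[ℂ] K)) (v : K) : Submodule ℂ K :=
  (orbitMap π v).range.topologicalClosure

instance (π : A →⋆ₐ[ℂ] (K →L[ℂ] K)) (v : K) : CompleteSpace (cyclic π v) :=
  (Submodule.isClosed_topologicalClosure _).completeSpace_coe

lemma map_mem_cyclic (π : A →⋆ₐ[ℂ] (K →L[ℂ] K)) (v : K) (a : A) : π a v ∈ cyclic π v :=
  Submodule.le_topologicalClosure _ ⟨a, rfl⟩

lemma map_mem_cyclic_of_mem (π : A →⋆ₐ[ℂ] (K →L[ℂ] K)) (v : K) (a : A) {w : K}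
    (hw : w ∈ cyclic π v) : π a w ∈ cyclic π v := by
  have h : cyclic π v ≤ (cyclic π v).comap (π a : K →ₗ[ℂ] K) := by
    refine Submodule.topologicalClosure_minimal _ ?_ ?_
    · rintro _ ⟨b, rfl⟩
      have := map_mem_cyclic π v (a * b)
      rw [map_mul] at this
      exact this
    · exact (Submodule.isClosed_topologicalClosure _).preimage (π a).continuous
  exact h hw

/-- A closed subspace invariant under `T` and its adjoint reduces `T`. -/
lemma map_starProjection_comm (U : Submodule ℂ K) [U.HasOrthogonalProjection] (T : K →L[ℂ] K)
    (hT : ∀ w ∈ U, T w ∈ U) (hT' : ∀ w ∈ U, ContinuousLinearMap.adjoint T w ∈ U) (w : K) :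
    T (U.starProjection w) = U.starProjection (T w) := by
  have h : T w = T (U.starProjection w) + T (w - U.starProjection w) := by
    rw [← map_add]; simp
  rw [h, map_add, Submodule.starProjection_eq_self_iff.2 (hT _ (U.starProjection_apply_mem w))]
  have h2 : T (w - U.starProjection w) ∈ Uᗮ := by
    rw [Submodule.mem_orthogonal]
    intro u hu
    rw [← ContinuousLinearMap.adjoint_inner_left]
    exact Submodule.sub_starProjection_mem_orthogonal w _ (hT' _ hu)
  rw [(Submodule.starProjection_apply_eq_zero_iff U).2 h2, add_zero]

/-- A closed subspace invariant under `π` reduces `π`. -/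
lemma commute_starProjection (π : A →⋆ₐ[ℂ] (K →L[ℂ] K)) (U : Submodule ℂ K)
    [U.HasOrthogonalProjection] (hU : ∀ a, ∀ w ∈ U, π a w ∈ U) (a : A) (w : K) :
    π a (U.starProjection w) = U.starProjection (π a w) := by
  refine map_starProjection_comm U (π a) (hU a) (fun w hw => ?_) w
  rw [← ContinuousLinearMap.star_eq_adjoint, ← map_star]
  exact hU _ _ hw

variable [PartialOrder A] [StarOrderedRing A]

/-- The cyclic vector of the GNS representation. -/
def gnsVector (ω : A →ₚ[ℂ] ℂ) : ω.GNS := (ω.toPreGNS 1 : ω.PreGNS)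

lemma gnsStarAlgHom_gnsVector (ω : A →ₚ[ℂ] ℂ) (a : A) :
    ω.gnsStarAlgHom a (gnsVector ω) = ((ω.toPreGNS a : ω.PreGNS) : ω.GNS) := by
  change ω.gnsNonUnitalStarAlgHom a ((ω.toPreGNS 1 : ω.PreGNS) : ω.GNS) = _
  rw [PositiveLinearMap.gnsNonUnitalStarAlgHom_apply_coe]
  simp

lemma inner_gnsVector (ω : A →ₚ[ℂ] ℂ) (a : A) :
    ⟪gnsVector ω, ω.gnsStarAlgHom a (gnsVector ω)⟫_ℂ = ω a := by
  rw [gnsStarAlgHom_gnsVector, gnsVector, UniformSpace.Completion.inner_coe,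
    PositiveLinearMap.preGNS_inner_def]
  simp

/-- A positive functional dominated by a vector functional of `π` is again a vector functional,
with vector obtained from the given one by a positive contraction in the commutant of `π`. -/
theorem exists_commutant_of_le (π : A →⋆ₐ[ℂ] (K →L[ℂ] K)) (ξ : K) (ω : A →ₚ[ℂ] ℂ)
    (h : ∀ x, (ω (star x * x)).re ≤ ‖π x ξ‖ ^ 2) :
    ∃ T : K →L[ℂ] K, IsSelfAdjoint T ∧ ‖T‖ ≤ 1 ∧ (∀ a, Commute T (π a)) ∧
      ∀ x, ω x = ⟪T ξ, π x (T ξ)⟫_ℂ := by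
  let L := cyclic π ξ
  let e : A →ₗ[ℂ] L := (orbitMap π ξ).codRestrict L fun a => map_mem_cyclic π ξ a
  let f : A →ₗ[ℂ] ω.GNS := orbitMap ω.gnsStarAlgHom (gnsVector ω)
  have hde : DenseRange e := by
    intro ⟨w, hw⟩
    rw [closure_subtype]
    have : (Subtype.val '' Set.range e) = ((orbitMap π ξ).range : Set K) := by
      ext z
      constructor
      · rintro ⟨_, ⟨a, rfl⟩, rfl⟩
        exact ⟨a, rfl⟩
      · rintro ⟨a, rfl⟩
        exact ⟨_, ⟨a, rfl⟩, rfl⟩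
    rw [this]
    exact hw
  -- The domination hypothesis says exactly that `π(x)ξ ↦ x Ω`, with `Ω` the GNS vector of `ω`, is a
  -- well-defined contraction.
  have hfe : ∀ x, ‖f x‖ ≤ 1 * ‖e x‖ := by
    intro x
    rw [one_mul]
    have h1 : ‖f x‖ ^ 2 ≤ ‖e x‖ ^ 2 := by
      have h2 := inner_map_star_mul_self ω.gnsStarAlgHom x (gnsVector ω)
      rw [inner_gnsVector] at h2
      have h3 := h x
      rw [h2, Complex.ofReal_re] at h3
      exact h3
    exact le_of_sq_le_sq h1 (norm_nonneg _)
  let V₀ : L →L[ℂ] ω.GNS := f.extendOfNorm e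
  have hV₀ : ∀ x, V₀ (e x) = f x := fun x => LinearMap.extendOfNorm_eq hde ⟨1, hfe⟩ x
  have hV₀n : ‖V₀‖ ≤ 1 := LinearMap.opNorm_extendOfNorm_le hde zero_le_one hfe
  -- Extended by zero on the complement of the cyclic subspace, which reduces `π`; so `V`
  -- intertwines the two representations on all of `K`.
  let V : K →L[ℂ] ω.GNS := V₀ ∘L L.orthogonalProjectionOnto
  have hVL : ∀ w : L, V w = V₀ w := by
    intro w
    simp [V]
  have hVx : ∀ x, V (π x ξ) = ω.gnsStarAlgHom x (gnsVector ω) := by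
    intro x
    exact (hVL (e x)).trans (hV₀ x)
  have hVn : ‖V‖ ≤ 1 := by
    refine (ContinuousLinearMap.opNorm_comp_le _ _).trans ?_
    exact mul_le_one₀ hV₀n (norm_nonneg _) L.orthogonalProjectionOnto_norm_le
  have hVint : ∀ a w, V (π a w) = ω.gnsStarAlgHom a (V w) := by
    intro a w
    have key : ∀ w : L, V (π a w) = ω.gnsStarAlgHom a (V w) := by
      have hcl : IsClosed {w : L | V (π a w) = ω.gnsStarAlgHom a (V w)} :=
        isClosed_eq (by fun_prop) (by fun_prop)
      intro w
      refine hcl.closure_subset_iff.2 ?_ (hde w)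
      rintro _ ⟨b, rfl⟩
      change V (π a (π b ξ)) = ω.gnsStarAlgHom a (V (π b ξ))
      rw [hVx, ← mul_apply_eq_comp, ← map_mul, hVx, map_mul]
      rfl
    have hP : ∀ w, V w = V (L.starProjection w) := by
      intro w
      exact (hVL (L.orthogonalProjectionOnto w)).symm
    rw [hP (π a w), ← commute_starProjection π L (fun a w hw => map_mem_cyclic_of_mem π ξ a hw),
      hP w]
    exact key (L.orthogonalProjectionOnto w)
  -- Since `V` intertwines, `V⋆V` lies in the commutant of `π`, and so does its square root `T`;
  -- then `⟪Tξ, π(x)Tξ⟫ = ⟪Vξ, Vπ(x)ξ⟫ = ω x`.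
  let S : K →L[ℂ] K := ContinuousLinearMap.adjoint V ∘L V
  have hS0 : 0 ≤ S := by
    rw [ContinuousLinearMap.nonneg_iff_isPositive]
    exact ContinuousLinearMap.isPositive_adjoint_comp_self V
  have hSc : ∀ a, Commute S (π a) := by
    intro a
    ext w
    refine ext_inner_left ℂ fun u => ?_
    change ⟪u, ContinuousLinearMap.adjoint V (V (π a w))⟫_ℂ =
      ⟪u, π a (ContinuousLinearMap.adjoint V (V w))⟫_ℂ
    rw [ContinuousLinearMap.adjoint_inner_right, hVint, ← inner_map_star π a,
      ContinuousLinearMap.adjoint_inner_right, hVint, inner_map_star]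
  let T := CFC.sqrt S
  have hTsa : IsSelfAdjoint T := (CFC.sqrt_nonneg S).isSelfAdjoint
  have hTT : T * T = S := CFC.sqrt_mul_sqrt_self _ hS0
  have hTc : ∀ a, Commute T (π a) := fun a => (hSc a).cfcₙ_nnreal _
  refine ⟨T, hTsa, ?_, hTc, ?_⟩
  · have h1 : ‖T‖ * ‖T‖ = ‖S‖ := by
      rw [← CStarRing.norm_star_mul_self, hTsa.star_eq, hTT]
    have h2 : ‖S‖ ≤ 1 := by
      refine (ContinuousLinearMap.opNorm_comp_le _ _).trans ?_
      rw [LinearIsometryEquiv.norm_map]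
      exact mul_le_one₀ hVn (norm_nonneg _) hVn
    nlinarith [norm_nonneg T]
  · intro x
    have h1 : π x (T ξ) = T (π x ξ) := (DFunLike.congr_fun (hTc x).eq ξ).symm
    have h2 : ⟪T ξ, T (π x ξ)⟫_ℂ = ⟪ξ, S (π x ξ)⟫_ℂ := by
      rw [← hTT, mul_apply_eq_comp]
      conv_lhs => rw [← hTsa.star_eq, ContinuousLinearMap.star_eq_adjoint,
        ContinuousLinearMap.adjoint_inner_left, ← ContinuousLinearMap.star_eq_adjoint,
        hTsa.star_eq]
    rw [h1, h2]
    change _ = ⟪ξ, ContinuousLinearMap.adjoint V (V (π x ξ))⟫_ℂ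
    rw [ContinuousLinearMap.adjoint_inner_right, hVx]
    have h3 := hVx 1
    rw [map_one, one_apply_eq_self, map_one, one_apply_eq_self] at h3
    rw [h3, inner_gnsVector]

end RadonNikodym

/-! ### Countable amplification of a representation, and vector functionals. -/

section Amplification

/-- The Hilbert space of square summable sequences in `K`. -/
abbrev L2 (K : Type*) [NormedAddCommGroup K] : Type _ := lp (fun _ : ℕ => K) 2

variable {K : Type*} [NormedAddCommGroup K]

lemma L2.hasSum_norm_sq (f : L2 K) : HasSum (fun n => ‖f n‖ ^ 2) (‖f‖ ^ 2) := by
  have := lp.hasSum_norm (p := 2) (by norm_num) f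
  simpa using this

lemma L2.summable_prod {ζ : ℕ → L2 K} (hζ : Summable fun k => ‖ζ k‖ ^ 2) :
    Summable fun p : ℕ × ℕ => ‖ζ p.1 p.2‖ ^ 2 := by
  rw [summable_prod_of_nonneg (fun p => by positivity)]
  refine ⟨fun k => (L2.hasSum_norm_sq (ζ k)).summable, ?_⟩
  simpa only [(L2.hasSum_norm_sq (ζ _)).tsum_eq] using hζ

/-- The sequence `v` as an element of `L2 K`. -/
def L2.mk (v : ℕ → K) (hv : Summable fun n => ‖v n‖ ^ 2) : L2 K :=
  ⟨v, memℓp_gen (by simpa using hv)⟩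

@[simp] lemma L2.mk_apply (v : ℕ → K) (hv : Summable fun n => ‖v n‖ ^ 2) (n : ℕ) :
    L2.mk v hv n = v n := rfl

variable [InnerProductSpace ℂ K]

/-- Entrywise application of an operator. -/
def L2.map (T : K →L[ℂ] K) : L2 K →L[ℂ] L2 K :=
  LinearMap.mkContinuous
    { toFun := fun f => L2.mk (fun n => T (f n)) (by
        refine Summable.of_nonneg_of_le (fun n => by positivity) (fun n => ?_)
          ((L2.hasSum_norm_sq f).summable.mul_left (‖T‖ ^ 2))
        rw [← mul_pow]
        gcongr
        exact T.le_opNorm _)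
      map_add' := fun f g => by ext n; simp
      map_smul' := fun c f => by ext n; simp }
    ‖T‖ (by
      intro f
      refine le_of_sq_le_sq ?_ (by positivity)
      rw [mul_pow]
      refine hasSum_le (fun n => ?_) (L2.hasSum_norm_sq _)
        ((L2.hasSum_norm_sq f).mul_left (‖T‖ ^ 2))
      rw [← mul_pow]
      gcongr
      exact T.le_opNorm _)

@[simp] lemma L2.map_apply (T : K →L[ℂ] K) (f : L2 K) (n : ℕ) : L2.map T f n = T (f n) := rfl

variable [CompleteSpace K] {A : Type*} [CStarAlgebra A]

/-- The countable amplification of a representation. -/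
def amp (π : A →⋆ₐ[ℂ] (K →L[ℂ] K)) : A →⋆ₐ[ℂ] (L2 K →L[ℂ] L2 K) where
  toFun a := L2.map (π a)
  map_one' := by ext f n; simp
  map_mul' a b := by ext f n; simp
  map_zero' := by ext f n; simp
  map_add' a b := by ext f n; simp
  commutes' c := by ext f n; simp [Algebra.algebraMap_eq_smul_one]
  map_star' a := by
    rw [ContinuousLinearMap.star_eq_adjoint, ContinuousLinearMap.eq_adjoint_iff]
    intro f g
    rw [lp.inner_eq_tsum, lp.inner_eq_tsum]
    congr 1
    ext n
    exact inner_map_star π a _ _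

@[simp] lemma amp_apply (π : A →⋆ₐ[ℂ] (K →L[ℂ] K)) (a : A) (f : L2 K) (n : ℕ) :
    amp π a f n = π a (f n) := rfl

/-- The vector functional `a ↦ ⟪u, π(a) u⟫`. -/
def vecState (π : A →⋆ₐ[ℂ] (K →L[ℂ] K)) (u : K) : A →ₗ[ℂ] ℂ where
  toFun a := ⟪u, π a u⟫_ℂ
  map_add' a b := by simp
  map_smul' c a := by simp

lemma vecState_apply (π : A →⋆ₐ[ℂ] (K →L[ℂ] K)) (u : K) (a : A) :
    vecState π u a = ⟪u, π a u⟫_ℂ := rfl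

lemma vecState_star_mul_self (π : A →⋆ₐ[ℂ] (K →L[ℂ] K)) (u : K) (a : A) :
    vecState π u (star a * a) = (‖π a u‖ ^ 2 : ℝ) := inner_map_star_mul_self π a u

lemma vecState_one (π : A →⋆ₐ[ℂ] (K →L[ℂ] K)) (u : K) :
    vecState π u 1 = (‖u‖ ^ 2 : ℝ) := by
  simpa using vecState_star_mul_self π u 1

/-- Positivity of a functional on a C⋆-algebra. -/
def IsPos (ω : A →ₗ[ℂ] ℂ) : Prop := ∀ x, 0 ≤ ω (star x * x)

lemma isPos_vecState (π : A →⋆ₐ[ℂ] (K →L[ℂ] K)) (u : K) : IsPos (vecState π u) := by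
  intro x
  rw [vecState_star_mul_self]
  exact Complex.zero_le_real.2 (sq_nonneg _)

lemma IsPos.add {ω ω' : A →ₗ[ℂ] ℂ} (hω : IsPos ω) (hω' : IsPos ω') : IsPos (ω + ω') :=
  fun x => add_nonneg (hω x) (hω' x)

variable [PartialOrder A] [StarOrderedRing A]

lemma IsPos.map_nonneg {ω : A →ₗ[ℂ] ℂ} (hω : IsPos ω) {x : A} (hx : 0 ≤ x) : 0 ≤ ω x := by
  obtain ⟨y, rfl⟩ := CStarAlgebra.nonneg_iff_eq_star_mul_self.1 hx
  exact hω y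

lemma IsPos.mono {ω : A →ₗ[ℂ] ℂ} (hω : IsPos ω) {x y : A} (h : x ≤ y) : ω x ≤ ω y := by
  have := hω.map_nonneg (sub_nonneg.2 h)
  rwa [map_sub, sub_nonneg] at this

/-- A positive functional as a bundled positive linear map. -/
def IsPos.toPositiveLinearMap {ω : A →ₗ[ℂ] ℂ} (hω : IsPos ω) : A →ₚ[ℂ] ℂ :=
  PositiveLinearMap.mk₀ ω fun _ hx => hω.map_nonneg hx

theorem IsPos.exists_commutant_of_le (π : A →⋆ₐ[ℂ] (K →L[ℂ] K)) (ξ : K) {ω : A →ₗ[ℂ] ℂ}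
    (hω : IsPos ω) (h : ∀ x, (ω (star x * x)).re ≤ ‖π x ξ‖ ^ 2) :
    ∃ T : K →L[ℂ] K, IsSelfAdjoint T ∧ ‖T‖ ≤ 1 ∧ (∀ a, Commute T (π a)) ∧
      ω = vecState π (T ξ) := by
  obtain ⟨T, h1, h2, h3, h4⟩ := NCErgodic.exists_commutant_of_le π ξ hω.toPositiveLinearMap h
  exact ⟨T, h1, h2, h3, LinearMap.ext h4⟩

end Amplification

/-! ### Positive normal functionals: vector form, domination, countable sums. -/

section Normal

variable {H : Type*} [NormedAddCommGroup H] [InnerProductSpace ℂ H] [CompleteSpace H]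
variable {M : VonNeumannAlgebra H}

/-- The amplified identity representation. -/
def normalRep (M : VonNeumannAlgebra H) : Elem M →⋆ₐ[ℂ] (L2 H →L[ℂ] L2 H) :=
  amp (A := Elem M) M.toStarSubalgebra.subtype

@[simp] lemma normalRep_apply (x : Elem M) (f : L2 H) (n : ℕ) :
    normalRep M x f n = (x : H →L[ℂ] H) (f n) := rfl

lemma isNormal_iff (ω : Elem M →ₗ[ℂ] ℂ) :
    IsNormal ω ↔ ∃ ξ η : L2 H, ∀ x, ω x = ⟪ξ, normalRep M x η⟫_ℂ := by
  constructor
  · rintro ⟨ξ, η, hξ, hη, h⟩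
    refine ⟨L2.mk ξ hξ, L2.mk η hη, fun x => ?_⟩
    rw [h, lp.inner_eq_tsum]
    rfl
  · rintro ⟨ξ, η, h⟩
    refine ⟨ξ, η, (L2.hasSum_norm_sq ξ).summable, (L2.hasSum_norm_sq η).summable, fun x => ?_⟩
    rw [h, lp.inner_eq_tsum]
    rfl

lemma isNormal_vecState_normalRep (ζ : L2 H) : IsNormal (vecState (normalRep M) ζ) :=
  (isNormal_iff _).2 ⟨ζ, ζ, fun _ => rfl⟩

/-- A positive normal functional is a vector functional of the amplified identity
representation. -/
theorem IsPos.exists_eq_vecState {ω : Elem M →ₗ[ℂ] ℂ} (hω : IsPos ω) (hn : IsNormal ω) :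
    ∃ ζ : L2 H, ω = vecState (normalRep M) ζ := by
  obtain ⟨ξ, η, h⟩ := (isNormal_iff _).1 hn
  -- Polarization: `ω (x⋆x) = Re ⟪xξ, xη⟫ = (‖x(ξ+η)‖² - ‖x(ξ-η)‖²) / 4`, so `ω` is dominated by the
  -- functional of `(ξ+η)/2`.
  obtain ⟨T, -, -, -, hT⟩ := hω.exists_commutant_of_le (normalRep M) ((1 / 2 : ℂ) • (ξ + η)) (by
    intro x
    have h1 : ω (star x * x) = ⟪normalRep M x ξ, normalRep M x η⟫_ℂ := by
      rw [h, map_mul, mul_apply_eq_comp, ← inner_map_star, star_star]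
    have h2 := re_inner_eq_norm_add_mul_self_sub_norm_sub_mul_self_div_four (𝕜 := ℂ)
      (normalRep M x ξ) (normalRep M x η)
    rw [h1, map_smul, norm_smul, map_add]
    simp only [RCLike.re_eq_complex_re] at h2
    rw [h2, mul_pow]
    norm_num
    nlinarith [mul_self_nonneg ‖normalRep M x ξ - normalRep M x η‖])
  exact ⟨_, hT⟩

/-- A positive functional dominated by a positive normal functional is normal. -/
theorem IsPos.isNormal_of_le {ω ω' : Elem M →ₗ[ℂ] ℂ} (hω : IsPos ω) (hω' : IsPos ω')
    (hn : IsNormal ω') (h : ∀ x, (ω (star x * x)).re ≤ (ω' (star x * x)).re) : IsNormal ω := by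
  obtain ⟨ζ, rfl⟩ := hω'.exists_eq_vecState hn
  obtain ⟨T, -, -, -, rfl⟩ := hω.exists_commutant_of_le (normalRep M) ζ (by
    intro x
    refine (h x).trans_eq ?_
    rw [vecState_star_mul_self, Complex.ofReal_re])
  exact isNormal_vecState_normalRep _

lemma isNormal_of_prod {w : ℕ × ℕ → H} (hw : Summable fun p => ‖w p‖ ^ 2)
    {ω : Elem M →ₗ[ℂ] ℂ}
    (hω : ∀ x : Elem M, ω x = ∑' k, ∑' n, ⟪w (k, n), (x : H →L[ℂ] H) (w (k, n))⟫_ℂ) :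
    IsNormal ω := by
  have hv : Summable fun n => ‖w (Nat.pairEquiv.symm n)‖ ^ 2 :=
    hw.comp_injective Nat.pairEquiv.symm.injective
  refine ⟨fun n => w (Nat.pairEquiv.symm n), fun n => w (Nat.pairEquiv.symm n), hv, hv,
    fun x => ?_⟩
  have hsum : Summable fun p : ℕ × ℕ => ⟪w p, (x : H →L[ℂ] H) (w p)⟫_ℂ := by
    refine Summable.of_norm_bounded (hw.mul_left ‖(x : H →L[ℂ] H)‖) fun p => ?_
    refine (norm_inner_le_norm _ _).trans ?_
    have := (x : H →L[ℂ] H).le_opNorm (w p)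
    nlinarith [norm_nonneg (w p)]
  rw [hω, ← hsum.tsum_prod, ← Nat.pairEquiv.symm.tsum_eq]

/-- A countable sum of positive normal functionals with summable masses is normal. -/
theorem isNormal_of_tsum {ν : ℕ → Elem M →ₗ[ℂ] ℂ} (hν : ∀ k, IsPos (ν k))
    (hn : ∀ k, IsNormal (ν k)) (hs : Summable fun k => (ν k 1).re) {ω : Elem M →ₗ[ℂ] ℂ}
    (hω : ∀ x, ω x = ∑' k, ν k x) : IsNormal ω := by
  choose ζ hζ using fun k => (hν k).exists_eq_vecState (hn k)
  have hs' : Summable fun k => ‖ζ k‖ ^ 2 := by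
    refine hs.congr fun k => ?_
    rw [hζ k, vecState_one, Complex.ofReal_re]
  refine isNormal_of_prod (L2.summable_prod hs') fun x => ?_
  rw [hω]
  refine tsum_congr fun k => ?_
  rw [hζ k, vecState_apply, lp.inner_eq_tsum]
  exact tsum_congr fun n => by rw [normalRep_apply]

end Normal

/-! ### The closed subspace of normal vectors of a representation. -/

section NormalVectors

variable {H : Type*} [NormedAddCommGroup H] [InnerProductSpace ℂ H] [CompleteSpace H]
variable {M : VonNeumannAlgebra H}
variable {K : Type*} [NormedAddCommGroup K] [InnerProductSpace ℂ K] [CompleteSpace K]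

lemma norm_rep_apply_le (π : Elem M →⋆ₐ[ℂ] (K →L[ℂ] K)) (x : Elem M) (u : K) :
    ‖π x u‖ ≤ ‖x‖ * ‖u‖ :=
  ((π x).le_opNorm u).trans
    (mul_le_mul_of_nonneg_right (NonUnitalStarAlgHom.norm_apply_le π x) (norm_nonneg _))

lemma norm_vecState_le (π : Elem M →⋆ₐ[ℂ] (K →L[ℂ] K)) (u : K) (x : Elem M) :
    ‖vecState π u x‖ ≤ ‖x‖ * ‖u‖ ^ 2 := by
  rw [vecState_apply]
  refine (norm_inner_le_norm _ _).trans ?_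
  nlinarith [norm_rep_apply_le π x u, norm_nonneg u]

/-- The sum of a sequence of positive normal functionals with summable masses. -/
theorem exists_hasSum_normal {ν : ℕ → Elem M →ₗ[ℂ] ℂ} (hν : ∀ k, IsPos (ν k))
    (hn : ∀ k, IsNormal (ν k)) (hs : Summable fun k => (ν k 1).re) :
    ∃ ω : Elem M →ₗ[ℂ] ℂ, IsPos ω ∧ IsNormal ω ∧ ∀ x, HasSum (fun k => ν k x) (ω x) := by
  have hsum : ∀ x, Summable fun k => ν k x := by
    intro x
    refine Summable.of_norm_bounded (hs.mul_left ‖x‖) fun k => ?_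
    obtain ⟨ζ, hζ⟩ := (hν k).exists_eq_vecState (hn k)
    rw [hζ, vecState_one, Complex.ofReal_re]
    exact norm_vecState_le _ _ _
  let ω : Elem M →ₗ[ℂ] ℂ :=
    { toFun := fun x => ∑' k, ν k x
      map_add' := fun x y => by
        simp only [map_add]
        exact (hsum x).tsum_add (hsum y)
      map_smul' := fun c x => by
        simp only [map_smul, smul_eq_mul, RingHom.id_apply]
        exact tsum_mul_left }
  exact ⟨ω, fun x => tsum_nonneg fun k => hν k x, isNormal_of_tsum hν hn hs fun _ => rfl,
    fun x => (hsum x).hasSum⟩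

lemma isNormal_smul (c : ℂ) {ω : Elem M →ₗ[ℂ] ℂ} (h : IsNormal ω) : IsNormal (c • ω) := by
  obtain ⟨ξ, η, h⟩ := (isNormal_iff _).1 h
  refine (isNormal_iff _).2 ⟨ξ, c • η, fun x => ?_⟩
  rw [map_smul, inner_smul_right, ← h]
  rfl

lemma vecState_smul (π : Elem M →⋆ₐ[ℂ] (K →L[ℂ] K)) (c : ℂ) (u : K) :
    vecState π (c • u) = (starRingEnd ℂ c * c) • vecState π u := by
  ext x
  simp only [vecState_apply, map_smul, inner_smul_left, inner_smul_right, LinearMap.smul_apply,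
    smul_eq_mul]
  ring

/-- The functionals of the `w k` add up to a normal functional, and `h` says that it dominates the
functional of `u`. Stating the bound through finite partial sums serves both finite sums and limits
of vectors. -/
lemma isNormal_vecState_of_le_tsum (π : Elem M →⋆ₐ[ℂ] (K →L[ℂ] K)) {u : K} {w : ℕ → K}
    (hw : ∀ k, IsNormal (vecState π (w k))) (hs : Summable fun k => ‖w k‖ ^ 2)
    (h : ∀ (x : Elem M) (C : ℝ), (∀ s : Finset ℕ, ∑ k ∈ s, ‖π x (w k)‖ ^ 2 ≤ C) →
      ‖π x u‖ ^ 2 ≤ C) :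
    IsNormal (vecState π u) := by
  obtain ⟨Ω, hΩ, hΩn, hsum⟩ := exists_hasSum_normal (fun k => isPos_vecState π (w k)) hw (by
    simpa only [vecState_one, Complex.ofReal_re] using hs)
  refine (isPos_vecState π u).isNormal_of_le hΩ hΩn fun x => ?_
  rw [vecState_star_mul_self, Complex.ofReal_re]
  refine h x _ fun s => ?_
  have h1 := Complex.hasSum_re (hsum (star x * x))
  simp only [vecState_star_mul_self, Complex.ofReal_re] at h1
  exact sum_le_hasSum s (fun k _ => sq_nonneg _) h1

lemma isNormal_vecState_add (π : Elem M →⋆ₐ[ℂ] (K →L[ℂ] K)) {u v : K}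
    (hu : IsNormal (vecState π u)) (hv : IsNormal (vecState π v)) :
    IsNormal (vecState π (u + v)) := by
  have hsm : ∀ w, IsNormal (vecState π w) → IsNormal (vecState π ((2 : ℂ) • w)) := by
    intro w hw
    rw [vecState_smul]
    exact isNormal_smul _ hw
  -- The factor 2 absorbs the constant in `‖a + b‖² ≤ 2‖a‖² + 2‖b‖²`.
  let w : ℕ → K := fun k => if k = 0 then (2 : ℂ) • u else if k = 1 then (2 : ℂ) • v else 0
  refine isNormal_vecState_of_le_tsum π (w := w) (fun k => ?_) ?_ fun x C hC => ?_
  · by_cases h0 : k = 0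
    · simp only [w, h0, if_true]
      exact hsm u hu
    by_cases h1 : k = 1
    · simp only [w, h1, if_true]
      exact hsm v hv
    · simp only [w, h0, h1, if_false]
      have : vecState π (0 : K) = (0 : ℂ) • vecState π u := by
        ext x; simp [vecState_apply]
      rw [this]
      exact isNormal_smul _ hu
  · refine summable_of_ne_finset_zero (s := Finset.range 2) fun k hk => ?_
    have h0 : k ≠ 0 := by rintro rfl; simp at hk
    have h1 : k ≠ 1 := by rintro rfl; simp at hk
    simp [w, h0, h1]
  · have h1 := hC (Finset.range 2)
    simp only [Finset.sum_range_succ, Finset.sum_range_zero, w, map_smul, norm_smul, if_true,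
      one_ne_zero, if_false, mul_pow] at h1
    norm_num at h1
    rw [map_add]
    have h2 := norm_add_le (π x u) (π x v)
    have h3 : ‖π x u + π x v‖ ^ 2 ≤ (‖π x u‖ + ‖π x v‖) ^ 2 := by gcongr
    nlinarith [sq_nonneg (‖π x u‖ - ‖π x v‖), sq_nonneg (‖π x u‖), sq_nonneg (‖π x v‖)]

/-- The vectors of a representation whose vector functional is normal. -/
def normalVec (π : Elem M →⋆ₐ[ℂ] (K →L[ℂ] K)) : Submodule ℂ K where
  carrier := {u | IsNormal (vecState π u)}
  zero_mem' := by
    refine (isNormal_iff _).2 ⟨0, 0, fun x => ?_⟩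
    simp [vecState_apply]
  add_mem' hu hv := isNormal_vecState_add π hu hv
  smul_mem' c u hu := by
    change IsNormal _
    rw [vecState_smul]
    exact isNormal_smul _ hu

lemma mem_normalVec {π : Elem M →⋆ₐ[ℂ] (K →L[ℂ] K)} {u : K} :
    u ∈ normalVec π ↔ IsNormal (vecState π u) := Iff.rfl

lemma mem_normalVec_of_le {K' : Type*} [NormedAddCommGroup K'] [InnerProductSpace ℂ K']
    [CompleteSpace K'] {π : Elem M →⋆ₐ[ℂ] (K →L[ℂ] K)} {π' : Elem M →⋆ₐ[ℂ] (K' →L[ℂ] K')}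
    {u : K} {v : K'} (hv : v ∈ normalVec π') (h : ∀ x, ‖π x u‖ ≤ ‖π' x v‖) :
    u ∈ normalVec π := by
  refine (isPos_vecState π u).isNormal_of_le (isPos_vecState π' v) hv fun x => ?_
  rw [vecState_star_mul_self, vecState_star_mul_self, Complex.ofReal_re, Complex.ofReal_re]
  gcongr
  exact h x

/-- A limit `u` is a series of normal vectors `v k` with `‖v k‖ < 4⁻ᵏ` for `k ≥ 1`. Cauchy-Schwarz
with the weights `2⁻⁽ᵏ⁺¹⁾` bounds `‖π(x)u‖²` by the sum of the `‖π(x)(2ᵏ⁺¹ v k)‖²`, and the rescaled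
vectors are still square summable. -/
lemma isClosed_normalVec (π : Elem M →⋆ₐ[ℂ] (K →L[ℂ] K)) :
    IsClosed (normalVec π : Set K) := by
  refine isClosed_of_closure_subset fun u hu => ?_
  obtain ⟨v, hv, hvN, -, hvb⟩ := controlled_sum_of_mem_closure
    (s := (normalVec π).toAddSubgroup) hu (b := fun n => (1 / 4 : ℝ) ^ n) (fun n => by positivity)
  refine isNormal_vecState_of_le_tsum π (w := fun k => (2 ^ (k + 1) : ℂ) • v k)
    (fun k => (normalVec π).smul_mem _ (hvN k)) ?_ fun x C hC => ?_
  -- The bound on `v k` is available only from `k = 1` on.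
  · rw [← summable_nat_add_iff 1]
    refine Summable.of_nonneg_of_le (fun k => by positivity) (fun k => ?_)
      ((summable_geometric_of_lt_one (r := (1 / 4 : ℝ)) (by norm_num) (by norm_num)).mul_left 1)
    have h1 := (hvb (k + 1) k.succ_pos).le
    rw [norm_smul, norm_pow, Complex.norm_ofNat, mul_pow]
    calc ((2 : ℝ) ^ (k + 1 + 1)) ^ 2 * ‖v (k + 1)‖ ^ 2
        ≤ ((2 : ℝ) ^ (k + 1 + 1)) ^ 2 * ((1 / 4 : ℝ) ^ (k + 1)) ^ 2 := by gcongr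
      _ = 1 * (1 / 4 : ℝ) ^ k := by
        have h4 : ((2 : ℝ) ^ (k + 1 + 1)) ^ 2 = 16 * 4 ^ k := by
          rw [← pow_mul, show (k + 1 + 1) * 2 = 2 * k + 4 by ring, pow_add, pow_mul]
          norm_num
          ring
        have h5 : (4 : ℝ) ^ k * (1 / 4) ^ k = 1 := by rw [← mul_pow]; norm_num
        rw [h4, pow_succ (1 / 4 : ℝ) k]
        linear_combination (1 / 4 : ℝ) ^ k * h5
  · have hlim : Tendsto (fun n => ‖π x (∑ i ∈ Finset.range (n + 1), v i)‖ ^ 2) atTop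
        (𝓝 (‖π x u‖ ^ 2)) :=
      (((π x).continuous.tendsto _).comp hv).norm.pow 2
    refine le_of_tendsto' hlim fun n => ?_
    have h1 : ‖π x (∑ i ∈ Finset.range (n + 1), v i)‖ ≤
        ∑ i ∈ Finset.range (n + 1), (1 / 2 : ℝ) ^ (i + 1) * ‖π x ((2 ^ (i + 1) : ℂ) • v i)‖ := by
      rw [map_sum]
      refine (norm_sum_le _ _).trans (Finset.sum_le_sum fun i _ => ?_)
      rw [map_smul, norm_smul, norm_pow, Complex.norm_ofNat, ← mul_assoc, ← mul_pow]
      norm_num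
    have h2 := Finset.sum_mul_sq_le_sq_mul_sq (Finset.range (n + 1))
      (fun i => (1 / 2 : ℝ) ^ (i + 1)) (fun i => ‖π x ((2 ^ (i + 1) : ℂ) • v i)‖)
    have h3 : ∑ i ∈ Finset.range (n + 1), ((1 / 2 : ℝ) ^ (i + 1)) ^ 2 ≤ 1 := by
      have h4 : ∀ i : ℕ, ((1 / 2 : ℝ) ^ (i + 1)) ^ 2 = (1 / 4) * (1 / 4) ^ i := by
        intro i
        rw [← pow_mul, mul_comm, pow_mul, pow_succ']
        norm_num
      simp only [h4]
      rw [← Finset.mul_sum]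
      have h5 := (summable_geometric_of_lt_one (r := (1 / 4 : ℝ)) (by norm_num)
        (by norm_num)).sum_le_tsum (Finset.range (n + 1)) (fun i _ => by positivity)
      rw [tsum_geometric_of_lt_one (by norm_num) (by norm_num)] at h5
      norm_num at h5 ⊢
      linarith
    have h6 := hC (Finset.range (n + 1))
    calc ‖π x (∑ i ∈ Finset.range (n + 1), v i)‖ ^ 2 ≤ _ := by gcongr
      _ ≤ _ := h2
      _ ≤ 1 * C := mul_le_mul h3 h6 (Finset.sum_nonneg fun i _ => sq_nonneg _) zero_le_one
      _ = C := one_mul C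

instance (π : Elem M →⋆ₐ[ℂ] (K →L[ℂ] K)) : CompleteSpace (normalVec π) :=
  (isClosed_normalVec π).completeSpace_coe

lemma map_mem_normalVec_of_commute {π : Elem M →⋆ₐ[ℂ] (K →L[ℂ] K)} {T : K →L[ℂ] K}
    (hT : ∀ a, Commute T (π a)) {u : K} (hu : u ∈ normalVec π) : T u ∈ normalVec π := by
  have hu' := (normalVec π).smul_mem (‖T‖ : ℂ) hu
  refine mem_normalVec_of_le hu' fun x => ?_
  have h1 : π x (T u) = T (π x u) := (DFunLike.congr_fun (hT x).eq u).symm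
  rw [h1, map_smul, norm_smul, Complex.norm_real, norm_norm]
  exact T.le_opNorm _

/-- The functional of `u` is also that of some `ζ` in the amplified identity representation, so
`‖π(x)π(a)u‖ = ‖x a ζ‖`, and the functional of `aζ` is normal. -/
lemma map_mem_normalVec {π : Elem M →⋆ₐ[ℂ] (K →L[ℂ] K)} (a : Elem M) {u : K}
    (hu : u ∈ normalVec π) : π a u ∈ normalVec π := by
  obtain ⟨ζ, hζ⟩ := (isPos_vecState π u).exists_eq_vecState hu
  refine mem_normalVec_of_le (v := normalRep M a ζ) (isNormal_vecState_normalRep _) fun x => ?_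
  have h1 : ∀ b, ‖π b u‖ = ‖normalRep M b ζ‖ := by
    intro b
    have h2 := vecState_star_mul_self π u b
    rw [hζ, vecState_star_mul_self] at h2
    exact ((sq_eq_sq₀ (norm_nonneg _) (norm_nonneg _)).1 (Complex.ofReal_injective h2)).symm
  have h3 := h1 (x * a)
  rw [map_mul, map_mul] at h3
  exact h3.le

end NormalVectors

/-! ### The normal part of a vector, and its approximation from the orbit. -/

section NormalPart

variable {H : Type*} [NormedAddCommGroup H] [InnerProductSpace ℂ H] [CompleteSpace H]
variable {M : VonNeumannAlgebra H}
variable {K : Type*} [NormedAddCommGroup K] [InnerProductSpace ℂ K] [CompleteSpace K]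

/-- The orthogonal projection onto the normal vectors. -/
def normalProj (π : Elem M →⋆ₐ[ℂ] (K →L[ℂ] K)) : K →L[ℂ] K := (normalVec π).starProjection

lemma normalProj_mem (π : Elem M →⋆ₐ[ℂ] (K →L[ℂ] K)) (u : K) : normalProj π u ∈ normalVec π :=
  (normalVec π).starProjection_apply_mem u

lemma normalProj_eq_self {π : Elem M →⋆ₐ[ℂ] (K →L[ℂ] K)} {u : K} (hu : u ∈ normalVec π) :
    normalProj π u = u := Submodule.starProjection_eq_self_iff.2 hu

lemma map_normalProj (π : Elem M →⋆ₐ[ℂ] (K →L[ℂ] K)) (a : Elem M) (u : K) :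
    π a (normalProj π u) = normalProj π (π a u) :=
  commute_starProjection π _ (fun a _ hw => map_mem_normalVec a hw) a u

lemma normalProj_comm {π : Elem M →⋆ₐ[ℂ] (K →L[ℂ] K)} {T : K →L[ℂ] K} (hT : IsSelfAdjoint T)
    (hc : ∀ a, Commute T (π a)) (u : K) : T (normalProj π u) = normalProj π (T u) := by
  refine map_starProjection_comm _ T (fun w hw => map_mem_normalVec_of_commute hc hw)
    (fun w hw => ?_) u
  rw [← ContinuousLinearMap.star_eq_adjoint, hT.star_eq]
  exact map_mem_normalVec_of_commute hc hw

/-- The functional of the normal component of `u` dominates every positive normal functional that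
the functional of `u` dominates. -/
theorem le_vecState_normalProj (π : Elem M →⋆ₐ[ℂ] (K →L[ℂ] K)) {u : K} {ω : Elem M →ₗ[ℂ] ℂ}
    (hω : IsPos ω) (hn : IsNormal ω) (h : ∀ x, (ω (star x * x)).re ≤ ‖π x u‖ ^ 2) (x : Elem M) :
    (ω (star x * x)).re ≤ ‖π x (normalProj π u)‖ ^ 2 := by
  -- `ω` is the functional of `Tu` with `T` in the commutant. As `Tu` is a normal vector, `Tu = PTu
  -- = TPu` for the projection `P` onto the normal vectors, and `T` is a contraction.
  obtain ⟨T, hT, hT1, hTc, rfl⟩ := hω.exists_commutant_of_le π u h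
  rw [vecState_star_mul_self, Complex.ofReal_re, ← normalProj_eq_self (mem_normalVec.2 hn),
    ← normalProj_comm hT hTc]
  gcongr
  have h1 : π x (T (normalProj π u)) = T (π x (normalProj π u)) :=
    (DFunLike.congr_fun (hTc x).eq _).symm
  rw [h1]
  exact (T.le_of_opNorm_le hT1 _).trans_eq (one_mul _)

/-- The projection onto the cyclic subspace lies in the commutant, so it commutes with the
projection onto the normal vectors; since it fixes `v`, it fixes the normal component of `v`. -/
lemma normalProj_mem_cyclic (π : Elem M →⋆ₐ[ℂ] (K →L[ℂ] K)) (v : K) :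
    normalProj π v ∈ cyclic π v := by
  have hv : v ∈ cyclic π v := by
    have := map_mem_cyclic π v 1
    rwa [map_one, one_apply_eq_self] at this
  have hsa : IsSelfAdjoint (cyclic π v).starProjection := isSelfAdjoint_starProjection _
  have h := normalProj_comm (π := π) hsa (fun a => by
    ext w
    exact (commute_starProjection π _ (fun a _ hw => map_mem_cyclic_of_mem π v a hw) a w).symm) v
  rw [Submodule.starProjection_eq_self_iff.2 hv] at h
  exact Submodule.starProjection_eq_self_iff.1 h

lemma amp_single (π : Elem M →⋆ₐ[ℂ] (K →L[ℂ] K)) (a : Elem M) (i : ℕ) (u : K) :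
    amp π a (lp.single 2 i u) = lp.single 2 i (π a u) := by
  ext n
  rw [amp_apply]
  by_cases h : n = i
  · subst h
    simp
  · rw [lp.single_apply_ne _ _ _ h, lp.single_apply_ne _ _ _ h, map_zero]

lemma single_mem_normalVec {π : Elem M →⋆ₐ[ℂ] (K →L[ℂ] K)} (i : ℕ) {u : K}
    (hu : u ∈ normalVec π) : (lp.single 2 i u : L2 K) ∈ normalVec (amp π) := by
  refine mem_normalVec_of_le hu fun x => ?_
  rw [amp_single, lp.norm_single (by norm_num)]

lemma coord_mem_normalVec {π : Elem M →⋆ₐ[ℂ] (K →L[ℂ] K)} (i : ℕ) {f : L2 K}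
    (hf : f ∈ normalVec (amp π)) : f i ∈ normalVec π := by
  refine mem_normalVec_of_le hf fun x => ?_
  exact lp.norm_apply_le_norm (by norm_num) (amp π x f) i

/-- If `Re ⟪η, π(c) v⟫ = 0` for all self-adjoint `c`, then `Re ⟪η, P v⟫ = 0` for the normal
component `P v` of `v`. -/
lemma re_inner_normalProj_eq_zero (π : Elem M →⋆ₐ[ℂ] (K →L[ℂ] K)) {v η : K}
    (h : ∀ c, IsSelfAdjoint c → (⟪η, π c v⟫_ℂ).re = 0) : (⟪η, normalProj π v⟫_ℂ).re = 0 := by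
  -- For self-adjoint `c` the sum is twice the real part in `h`. Being complex linear in the algebra
  -- element, it then vanishes for every `a`.
  have h1 : ∀ a : Elem M, ⟪η, π a v⟫_ℂ + ⟪v, π a η⟫_ℂ = 0 := by
    have hsa : ∀ c : Elem M, IsSelfAdjoint c → ⟪η, π c v⟫_ℂ + ⟪v, π c η⟫_ℂ = 0 := by
      intro c hc
      have h2 : ⟪v, π c η⟫_ℂ = starRingEnd ℂ ⟪η, π c v⟫_ℂ := by
        rw [inner_conj_symm, ← inner_map_star, hc.star_eq]
      rw [h2, Complex.add_conj, h c hc]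
      simp
    intro a
    have h3 := hsa _ (realPart a).2
    have h4 := hsa _ (imaginaryPart a).2
    rw [← realPart_add_I_smul_imaginaryPart a]
    simp only [map_add, map_smul, add_apply, smul_apply, inner_add_right, inner_smul_right]
    linear_combination h3 + Complex.I * h4
  -- In two copies of `π`, `W = (η, v)` is orthogonal to every `π(a)V` with `V = (v, η)`, hence to
  -- the cyclic subspace of `V`. That subspace contains the normal component `(Pv, Pη)`, and `⟪W,
  -- (Pv, Pη)⟫ = 2 Re ⟪η, Pv⟫`.
  let V : L2 K := lp.single 2 0 v + lp.single 2 1 η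
  let W : L2 K := lp.single 2 0 η + lp.single 2 1 v
  let V' : L2 K := lp.single 2 0 (normalProj π v) + lp.single 2 1 (normalProj π η)
  have hV' : normalProj (amp π) V = V' := by
    refine Submodule.eq_starProjection_of_mem_of_inner_eq_zero ?_ fun U hU => ?_
    · exact add_mem (single_mem_normalVec 0 (normalProj_mem π v))
        (single_mem_normalVec 1 (normalProj_mem π η))
    · have h5 : V - V' = lp.single 2 0 (v - normalProj π v) +
          lp.single 2 1 (η - normalProj π η) := by
        simp only [V, V', lp.single_sub]
        abel
      have h6 : ∀ (i : ℕ) (w : K), ⟪w - normalProj π w, U i⟫_ℂ = 0 := fun i w =>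
        Submodule.starProjection_inner_eq_zero _ _ (coord_mem_normalVec i hU)
      rw [h5, inner_add_left, lp.inner_single_left, lp.inner_single_left, h6, h6, add_zero]
  have hW : ∀ x ∈ cyclic (amp π) V, ⟪W, x⟫_ℂ = 0 := by
    have hle : cyclic (amp π) V ≤ (innerSL ℂ W).ker := by
      refine Submodule.topologicalClosure_minimal _ ?_ (ContinuousLinearMap.isClosed_ker _)
      rintro _ ⟨a, rfl⟩
      rw [LinearMap.mem_ker]
      change ⟪W, amp π a V⟫_ℂ = 0
      simp only [V, W, map_add, amp_single, inner_add_left, inner_add_right,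
        lp.inner_single_left, lp.single_apply_self]
      rw [lp.single_apply_ne, lp.single_apply_ne] <;> simp [h1]
    intro x hx
    exact hle hx
  have h6 := hW _ (normalProj_mem_cyclic (amp π) V)
  rw [hV'] at h6
  simp only [V', W, inner_add_left, inner_add_right, lp.inner_single_left,
    lp.single_apply_self] at h6
  rw [lp.single_apply_ne _ _ _ (by norm_num), lp.single_apply_ne _ _ _ (by norm_num)] at h6
  have h7 : ⟪v, normalProj π η⟫_ℂ = starRingEnd ℂ ⟪η, normalProj π v⟫_ℂ := by
    rw [inner_conj_symm]
    exact (Submodule.inner_starProjection_left_eq_right _ _ _).symm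
  rw [h7] at h6
  simp only [inner_zero_right, add_zero, zero_add] at h6
  rw [Complex.add_conj] at h6
  have h8 : (2 * (⟪η, normalProj π v⟫_ℂ).re : ℝ) = 0 := by exact_mod_cast h6
  linarith

/-- The normal component of `v` is approximated by vectors `π(c) v` with `c` self-adjoint. -/
theorem exists_selfAdjoint_approx (π : Elem M →⋆ₐ[ℂ] (K →L[ℂ] K)) (v : K) {ε : ℝ} (hε : 0 < ε) :
    ∃ c, IsSelfAdjoint c ∧ ‖π c v - normalProj π v‖ < ε := by
  let S : Set K := {w | ∃ c, IsSelfAdjoint c ∧ π c v = w}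
  have hconv : Convex ℝ S := by
    rintro _ ⟨c, hc, rfl⟩ _ ⟨d, hd, rfl⟩ s t - - -
    refine ⟨(s : ℂ) • c + (t : ℂ) • d, ?_, ?_⟩
    · exact (IsSelfAdjoint.smul (Complex.conj_ofReal s) hc).add
        (IsSelfAdjoint.smul (Complex.conj_ofReal t) hd)
    · rw [map_add, map_smul, map_smul]
      rfl
  by_cases hmem : normalProj π v ∈ closure S
  · obtain ⟨_, ⟨c, hc, rfl⟩, h⟩ := Metric.mem_closure_iff.1 hmem ε hε
    exact ⟨c, hc, by rwa [← dist_eq_norm, dist_comm]⟩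
  exfalso
  obtain ⟨f, s, hs1, hs2⟩ :=
    RCLike.geometric_hahn_banach_closed_point (𝕜 := ℂ) hconv.closure isClosed_closure hmem
  let η := (InnerProductSpace.toDual ℂ K).symm f
  have hf : ∀ x, f x = ⟪η, x⟫_ℂ := fun x => InnerProductSpace.toDual_symm_apply.symm
  have hlt : ∀ c, IsSelfAdjoint c → (⟪η, π c v⟫_ℂ).re < s := by
    intro c hc
    have := hs1 _ (subset_closure ⟨c, hc, rfl⟩)
    rwa [hf] at this
  -- A functional bounded above on a real subspace vanishes there: otherwise rescaling by `s / r`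
  -- would attain the bound `s`.
  have hz : ∀ c, IsSelfAdjoint c → (⟪η, π c v⟫_ℂ).re = 0 := by
    intro c hc
    by_contra hne
    set r := (⟪η, π c v⟫_ℂ).re with hr
    have h1 := hlt (((s / r : ℝ) : ℂ) • c) (IsSelfAdjoint.smul (Complex.conj_ofReal _) hc)
    rw [map_smul, smul_apply, inner_smul_right, Complex.re_ofReal_mul, ← hr,
      div_mul_cancel₀ _ hne] at h1
    exact lt_irrefl _ h1
  have h0 := hlt 0 (IsSelfAdjoint.zero _)
  have h1 := re_inner_normalProj_eq_zero π hz
  rw [hf] at hs2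
  simp at h0
  have h2 : s < (⟪η, normalProj π v⟫_ℂ).re := hs2
  linarith

end NormalPart

/-! ### Functional calculus in a corner, and the norm of a positive functional. -/

section Algebra

variable {A : Type*} [CStarAlgebra A] [PartialOrder A] [StarOrderedRing A]

/-- A self-adjoint element `d` of the corner of a projection `f` gives `x = d²(κ + d²)⁻¹` in the
unit interval of that corner. -/
lemma exists_regularization {f d : A} (hf : IsStarProjection f) (hd : IsSelfAdjoint d)
    (hfd : f * d = d) (hdf : d * f = d) {κ : ℝ} (hκ : 0 < κ) :
    ∃ x : A, 0 ≤ x ∧ x ≤ f ∧ x ≤ κ⁻¹ • (d * d) ∧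
      f - x ≤ (2 : ℝ) • ((f - d) * (f - d)) + (2 * κ) • f := by
  have hpos : ∀ t : ℝ, 0 < κ + t ^ 2 := fun t => by positivity
  have hc1 : Continuous fun t : ℝ => t / (κ + t ^ 2) :=
    continuous_id.div (by fun_prop) fun t => (hpos t).ne'
  let y := cfc (fun t : ℝ => t / (κ + t ^ 2)) d
  let x := cfc (fun t : ℝ => t * (t / (κ + t ^ 2))) d
  have hid : cfc (fun t : ℝ => t) d = d := cfc_id' ℝ d
  -- Factoring `d` out on either side shows that `x` lies in the corner of `f`.
  have hxy : x = d * y := by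
    have h := cfc_mul (fun t : ℝ => t) (fun t : ℝ => t / (κ + t ^ 2)) d (by fun_prop)
      hc1.continuousOn
    rw [hid] at h
    exact h
  have hyx : x = y * d := by
    have h := cfc_mul (fun t : ℝ => t / (κ + t ^ 2)) (fun t : ℝ => t) d hc1.continuousOn
      (by fun_prop)
    rw [hid] at h
    rw [← h]
    exact congrArg (fun g => cfc g d) (funext fun t => mul_comm _ _)
  have hcx : Continuous fun t : ℝ => t * (t / (κ + t ^ 2)) := continuous_id.mul hc1
  have hx0 : 0 ≤ x := cfc_nonneg fun t _ => by
    have := hpos t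
    rw [← mul_div_assoc, ← sq]
    positivity
  have hx1 : x ≤ 1 := cfc_le_one _ _ fun t _ => by
    rw [← mul_div_assoc, ← sq, div_le_one (hpos t)]
    linarith
  have hfx : f * x = x := by rw [hxy, ← mul_assoc, hfd]
  have hxf : x * f = x := by rw [hyx, mul_assoc, hdf]
  have hff : f * f = f := hf.isIdempotentElem
  have hsf : star f = f := hf.isSelfAdjoint
  have hconj : ∀ {a b : A}, a ≤ b → f * a * f ≤ f * b * f := by
    intro a b hab
    have := star_left_conjugate_le_conjugate hab f
    rwa [hsf] at this
  refine ⟨x, hx0, ?_, ?_, ?_⟩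
  · have := hconj hx1
    rwa [hfx, hxf, mul_one, hff] at this
  · have h1 : κ⁻¹ • (d * d) = cfc (fun t : ℝ => κ⁻¹ * (t * t)) d := by
      rw [cfc_const_mul κ⁻¹ (fun t : ℝ => t * t) d (by fun_prop),
        cfc_mul (fun t : ℝ => t) (fun t : ℝ => t) d (by fun_prop) (by fun_prop), hid]
    rw [h1]
    refine cfc_mono (fun t _ => ?_) hcx.continuousOn (by fun_prop)
    rw [← mul_div_assoc, inv_mul_eq_div]
    gcongr
    all_goals nlinarith [sq_nonneg t]
  · have h2 : 1 - x ≤ (2 : ℝ) • ((1 - d) * (1 - d)) + (2 * κ) • (1 : A) := by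
      have h3 : 1 - x = cfc (fun t : ℝ => 1 - t * (t / (κ + t ^ 2))) d := by
        rw [cfc_sub (fun _ : ℝ => (1 : ℝ)) _ d (by fun_prop) hcx.continuousOn, cfc_const_one ℝ d]
      have h4 : (2 : ℝ) • ((1 - d) * (1 - d)) + (2 * κ) • (1 : A) =
          cfc (fun t : ℝ => 2 * ((1 - t) * (1 - t)) + 2 * κ) d := by
        rw [cfc_add_const (2 * κ) (fun t : ℝ => 2 * ((1 - t) * (1 - t))) d (by fun_prop),
          cfc_const_mul 2 (fun t : ℝ => (1 - t) * (1 - t)) d (by fun_prop),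
          cfc_mul (fun t : ℝ => 1 - t) (fun t : ℝ => 1 - t) d (by fun_prop) (by fun_prop),
          cfc_sub (fun _ : ℝ => (1 : ℝ)) (fun t : ℝ => t) d (by fun_prop) (by fun_prop),
          cfc_const_one ℝ d, hid, Algebra.algebraMap_eq_smul_one]
      rw [h3, h4]
      refine cfc_mono (fun t _ => ?_) (continuous_const.sub hcx).continuousOn (by fun_prop)
      have h5 := hpos t
      rw [← mul_div_assoc, sub_le_iff_le_add, ← sub_le_iff_le_add', le_div_iff₀ h5]
      nlinarith [sq_nonneg (1 - t), sq_nonneg t, sq_nonneg ((1 - t) * t), sq_nonneg (2 * t - 1),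
        mul_pos hκ hκ, mul_nonneg hκ.le (sq_nonneg (2 * t - 1)), mul_nonneg hκ.le (sq_nonneg t)]
    have h6 := hconj h2
    have h7 : f * (1 - x) * f = f - x := by
      rw [mul_sub, mul_one, hfx, sub_mul, hff, hxf]
    have h8 : f * ((2 : ℝ) • ((1 - d) * (1 - d)) + (2 * κ) • (1 : A)) * f =
        (2 : ℝ) • ((f - d) * (f - d)) + (2 * κ) • f := by
      have h9 : f - d = f * (1 - d) := by rw [mul_sub, mul_one, hfd]
      have h10 : f - d = (1 - d) * f := by rw [sub_mul, one_mul, hdf]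
      rw [mul_add, add_mul, mul_smul_comm, smul_mul_assoc, mul_smul_comm, smul_mul_assoc, mul_one,
        hff]
      congr 2
      nth_rw 1 [h9]
      rw [h10]
      simp only [mul_assoc]
    rwa [h7, h8] at h6

lemma IsPos.eq_vecState_gns {ω : A →ₗ[ℂ] ℂ} (hω : IsPos ω) :
    ω = vecState hω.toPositiveLinearMap.gnsStarAlgHom (gnsVector hω.toPositiveLinearMap) :=
  LinearMap.ext fun a => (inner_gnsVector hω.toPositiveLinearMap a).symm

/-- Automatic boundedness, read off from the GNS vector, whose squared norm is `ω 1`. -/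
lemma IsPos.norm_apply_le {ω : A →ₗ[ℂ] ℂ} (hω : IsPos ω) (x : A) :
    ‖ω x‖ ≤ ‖x‖ * (ω 1).re := by
  rw [hω.eq_vecState_gns, vecState_one, Complex.ofReal_re, vecState_apply]
  refine (norm_inner_le_norm _ _).trans ?_
  have h1 := (hω.toPositiveLinearMap.gnsStarAlgHom x).le_opNorm (gnsVector hω.toPositiveLinearMap)
  have h2 := NonUnitalStarAlgHom.norm_apply_le hω.toPositiveLinearMap.gnsStarAlgHom x
  have h3 := mul_le_mul_of_nonneg_right h2 (norm_nonneg (gnsVector hω.toPositiveLinearMap))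
  nlinarith [norm_nonneg (gnsVector hω.toPositiveLinearMap)]

end Algebra

/-! ### Normal parts of invariant functionals; singular functionals on a corner. -/

section InvariantFunctionals

variable {H : Type*} [NormedAddCommGroup H] [InnerProductSpace ℂ H] [CompleteSpace H]
variable {M : VonNeumannAlgebra H} {G : Type*} [Semigroup G] [TopologicalSpace G]
variable {K : Type*} [NormedAddCommGroup K] [InnerProductSpace ℂ K] [CompleteSpace K]

/-- The normal part of an invariant positive functional is invariant. -/
lemma isInvariant_normalProj (α : DynSystem M G) (π : Elem M →⋆ₐ[ℂ] (K →L[ℂ] K)) {u : K}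
    (hinv : IsInvariant α (vecState π u)) : IsInvariant α (vecState π (normalProj π u)) := by
  set ψ := vecState π u
  set ν := vecState π (normalProj π u) with hνdef
  have hν : IsPos ν := isPos_vecState _ _
  have hle : ∀ x : Elem M, ‖π x (normalProj π u)‖ ≤ ‖π x u‖ := by
    intro x
    rw [map_normalProj]
    exact Submodule.norm_starProjection_apply_le _ _
  have hσ : IsPos (ψ - ν) := by
    intro x
    rw [LinearMap.sub_apply, sub_nonneg]
    simp only [ψ, ν, vecState_star_mul_self]
    exact Complex.real_le_real.2 (by gcongr; exact hle x)
  intro g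
  set ω : Elem M →ₗ[ℂ] ℂ := ν ∘ₗ (α.act g : Elem M →ₗ[ℂ] Elem M) with hωdef
  have hact : ∀ x, 0 ≤ α.act g (star x * x) := fun x => α.act_nonneg g _ (star_mul_self_nonneg x)
  have hω : IsPos ω := fun x => hν.map_nonneg (hact x)
  have hωn : IsNormal ω := α.normal_act g ν (normalProj_mem π u)
  -- `ν ∘ α_g` is normal and below `ψ ∘ α_g = ψ`, so maximality of the normal part gives `ν ∘ α_g ≤
  -- ν`.
  have h1 := le_vecState_normalProj π (u := u) hω hωn (fun x => by
    have h2 := hσ.map_nonneg (hact x)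
    rw [LinearMap.sub_apply, sub_nonneg, hinv g] at h2
    have h3 := (Complex.le_def.1 h2).1
    rwa [show ψ (star x * x) = _ from vecState_star_mul_self π u x, Complex.ofReal_re] at h3)
  have hD : IsPos (ν - ω) := by
    intro x
    rw [LinearMap.sub_apply, sub_nonneg, Complex.le_def]
    refine ⟨?_, ?_⟩
    · refine (h1 x).trans_eq ?_
      rw [hνdef, vecState_star_mul_self, Complex.ofReal_re]
    · rw [← (Complex.le_def.1 (hω x)).2, ← (Complex.le_def.1 (hν x)).2]
  -- From `α_g(1) ≤ 1` the positive functional `ψ - ν` decreases at `1`, while `ψ(α_g 1) = ψ 1`;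
  -- hence `ν(α_g 1) ≥ ν 1`. A positive functional that is not positive at `1` is zero.
  have hone : ((ν - ω) 1).re ≤ 0 := by
    have h4 := (Complex.le_def.1 (hσ.mono (α.act_one_le g))).1
    have h5 : ψ (α.act g 1) = ψ 1 := hinv g 1
    simp only [LinearMap.sub_apply, Complex.sub_re, h5] at h4 ⊢
    change (ν 1).re - (ν (α.act g 1)).re ≤ 0
    linarith
  intro x
  have h6 := hD.norm_apply_le x
  have h7 : ‖(ν - ω) x‖ ≤ 0 :=
    h6.trans (mul_nonpos_of_nonneg_of_nonpos (norm_nonneg _) hone)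
  exact (sub_eq_zero.1 (norm_le_zero_iff.1 h7)).symm

/-- A positive normal invariant functional vanishes where all normal invariant states do. -/
lemma apply_eq_zero_of_states (α : DynSystem M G) {f : Elem M}
    (hf : ∀ ν : Elem M →ₗ[ℂ] ℂ, IsNormalState ν → IsInvariant α ν → ν f = 0)
    {ν : Elem M →ₗ[ℂ] ℂ} (hν : IsPos ν) (hn : IsNormal ν) (hinv : IsInvariant α ν) :
    ν f = 0 := by
  have h1 : 0 ≤ ν 1 := by simpa using hν 1
  by_cases h0 : ν 1 = 0
  · have h2 := hν.norm_apply_le f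
    rw [h0, Complex.zero_re, mul_zero] at h2
    exact norm_le_zero_iff.1 h2
  · have h3 := hf ((ν 1)⁻¹ • ν) ⟨⟨fun x => ?_, ?_⟩, isNormal_smul _ hn⟩ fun g x => ?_
    · rw [LinearMap.smul_apply, smul_eq_mul] at h3
      exact (mul_eq_zero.1 h3).resolve_left (inv_ne_zero h0)
    · exact mul_nonneg (inv_nonneg_of_nonneg h1) (hν x)
    · exact inv_mul_cancel₀ h0
    · rw [LinearMap.smul_apply, LinearMap.smul_apply, hinv g x]

/-- Version of `exists_small_of_isInvariant` for vector functionals of one representation. -/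
theorem exists_small_of_vecState (α : DynSystem M G) {f : Elem M} (hfp : IsStarProjection f)
    (hf : ∀ ν : Elem M →ₗ[ℂ] ℂ, IsNormalState ν → IsInvariant α ν → ν f = 0)
    (π : Elem M →⋆ₐ[ℂ] (K →L[ℂ] K)) {u ζ : K} (hζN : ζ ∈ normalVec π)
    (hinv : IsInvariant α (vecState π u)) {δ : ℝ} (hδ : 0 < δ) :
    ∃ x : Elem M, 0 ≤ x ∧ x ≤ f ∧ (vecState π ζ (f - x)).re ≤ δ ∧ (vecState π u x).re ≤ δ := by
  have hφ : IsPos (vecState π ζ) := isPos_vecState π ζ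
  have hψ : IsPos (vecState π u) := isPos_vecState π u
  set φ := vecState π ζ with hφdef
  set ψ := vecState π u with hψdef
  have hff : f * f = f := hfp.isIdempotentElem
  have hsf : star f = f := hfp.isSelfAdjoint
  have hπff : ∀ w, π f (π f w) = π f w := by
    intro w
    rw [← mul_apply_eq_comp, ← map_mul, hff]
  have hπf : ∀ w, ‖π f w‖ ≤ ‖w‖ := by
    intro w
    have h1 := norm_rep_apply_le π f w
    have h2 : ‖f‖ ≤ 1 := hfp.norm_le
    nlinarith [norm_nonneg w]
  -- The normal part of `ψ` is invariant, so it vanishes on `f`. Hence `π(f)u` has no normal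
  -- component, whereas `π(f)ζ` is normal.
  have hPu : π f (normalProj π u) = 0 := by
    have h1 := apply_eq_zero_of_states α hf (isPos_vecState π (normalProj π u))
      (normalProj_mem π u) (isInvariant_normalProj α π hinv)
    have h2 := vecState_star_mul_self π (normalProj π u) f
    rw [hsf, hff, h1] at h2
    have h3 : ‖π f (normalProj π u)‖ ^ 2 = 0 := (Complex.ofReal_injective h2).symm
    simpa using h3
  have hΞ : normalProj π (π f u) = 0 := by rw [← map_normalProj, hPu]
  have hZ : normalProj π (π f ζ) = π f ζ := by
    rw [← map_normalProj, normalProj_eq_self hζN]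
  have hF : 0 ≤ (φ f).re := by
    have := hφ f
    rw [hsf, hff] at this
    exact (Complex.le_def.1 this).1
  -- The final bounds are `φ(f - x) ≤ 2ε² + 2κ φ(f)` and `ψ(x) ≤ κ⁻¹(2ε)²`; so `κ` is chosen before
  -- `ε`.
  obtain ⟨κ, hκ, hκδ⟩ : ∃ κ : ℝ, 0 < κ ∧ 2 * κ * (φ f).re ≤ δ / 2 := by
    refine ⟨δ / (4 * ((φ f).re + 1)), by positivity, ?_⟩
    rw [show 2 * (δ / (4 * ((φ f).re + 1))) * (φ f).re =
      δ / 2 * ((φ f).re / ((φ f).re + 1)) by field_simp; ring]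
    refine mul_le_of_le_one_right (by positivity) ?_
    rw [div_le_one (by positivity)]
    linarith
  obtain ⟨ε, hε, hε1, hε2⟩ : ∃ ε : ℝ, 0 < ε ∧ 2 * ε ^ 2 ≤ δ / 2 ∧ κ⁻¹ * (2 * ε) ^ 2 ≤ δ := by
    refine ⟨√(min (δ / 4) (κ * δ / 4)), by positivity, ?_, ?_⟩
    · rw [Real.sq_sqrt (by positivity)]
      linarith [min_le_left (δ / 4) (κ * δ / 4)]
    · rw [mul_pow, Real.sq_sqrt (by positivity), inv_mul_le_iff₀ hκ]
      linarith [min_le_right (δ / 4) (κ * δ / 4)]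
  -- The normal component of `π(f)u + π(f)ζ` is `π(f)ζ`, so some self-adjoint `c` nearly sends the
  -- sum to it. Projecting the error onto the normal vectors separates the two terms: `π(c)π(f)ζ ≈
  -- π(f)ζ` and `π(c)π(f)u ≈ 0`.
  obtain ⟨c, hc, hcε⟩ := exists_selfAdjoint_approx π (π f u + π f ζ) hε
  rw [map_add (normalProj π), hΞ, hZ, zero_add] at hcε
  set r := π c (π f u + π f ζ) - π f ζ with hr
  have hr1 : normalProj π r = π c (π f ζ) - π f ζ := by
    rw [hr, map_sub, ← map_normalProj, map_add, hΞ, hZ, zero_add]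
  have hr2 : ‖π c (π f ζ) - π f ζ‖ ≤ ε := by
    rw [← hr1]
    exact (Submodule.norm_starProjection_apply_le _ _).trans hcε.le
  have hr3 : ‖π c (π f u)‖ ≤ 2 * ε := by
    have h1 : π c (π f u) = r - (π c (π f ζ) - π f ζ) := by
      rw [hr, map_add]
      abel
    rw [h1]
    linarith [norm_sub_le r (π c (π f ζ) - π f ζ)]
  have hd : IsSelfAdjoint (f * c * f) := by
    have := hc.conjugate f
    rwa [hsf] at this
  have hdapp : ∀ w, π (f * c * f) w = π f (π c (π f w)) := by
    intro w
    rw [map_mul, map_mul]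
    rfl
  obtain ⟨x, hx0, hxf, hx1, hx2⟩ := exists_regularization hfp hd
    (by simp only [← mul_assoc, hff]) (by simp only [mul_assoc, hff]) hκ
  refine ⟨x, hx0, hxf, ?_, ?_⟩
  · have h1 := (Complex.le_def.1 (hφ.mono hx2)).1
    have h2 : (f - f * c * f) * (f - f * c * f) =
        star (f - f * c * f) * (f - f * c * f) := by
      rw [star_sub, hsf, hd.star_eq]
    have h3 : φ (star (f - f * c * f) * (f - f * c * f)) = (‖π (f - f * c * f) ζ‖ ^ 2 : ℝ) := by
      rw [hφdef, vecState_star_mul_self]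
    have h4 : ‖π (f - f * c * f) ζ‖ ≤ ε := by
      have h5 : π (f - f * c * f) ζ = - π f (π c (π f ζ) - π f ζ) := by
        rw [map_sub π, sub_apply, hdapp, map_sub, hπff]
        abel
      rw [h5, norm_neg]
      exact (hπf _).trans hr2
    rw [map_add, LinearMap.map_smul_of_tower, LinearMap.map_smul_of_tower, h2, h3, Complex.add_re,
      Complex.real_smul, Complex.real_smul, Complex.re_ofReal_mul, Complex.re_ofReal_mul,
      Complex.ofReal_re] at h1
    have h6 : ‖π (f - f * c * f) ζ‖ ^ 2 ≤ ε ^ 2 := by gcongr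
    linarith
  · have h1 := (Complex.le_def.1 (hψ.mono hx1)).1
    have h2 : ψ (f * c * f * (f * c * f)) = (‖π (f * c * f) u‖ ^ 2 : ℝ) := by
      nth_rw 1 [← hd.star_eq]
      rw [hψdef, vecState_star_mul_self]
    rw [LinearMap.map_smul_of_tower, h2, Complex.real_smul, Complex.re_ofReal_mul,
      Complex.ofReal_re, hdapp] at h1
    refine h1.trans (le_trans ?_ hε2)
    gcongr
    exact (hπf _).trans hr3

/-- If all normal invariant states vanish on the projection `f`, then every invariant positive
functional is small on some `x` in the unit interval of the corner of `f` which is close to `f`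
with respect to a given normal functional. -/
theorem exists_small_of_isInvariant (α : DynSystem M G) {f : Elem M} (hfp : IsStarProjection f)
    (hf : ∀ ν : Elem M →ₗ[ℂ] ℂ, IsNormalState ν → IsInvariant α ν → ν f = 0)
    {φ ψ : Elem M →ₗ[ℂ] ℂ} (hφ : IsPos φ) (hφn : IsNormal φ) (hψ : IsPos ψ)
    (hinv : IsInvariant α ψ) {δ : ℝ} (hδ : 0 < δ) :
    ∃ x : Elem M, 0 ≤ x ∧ x ≤ f ∧ (φ (f - x)).re ≤ δ ∧ (ψ x).re ≤ δ := by
  -- Both functionals lie below their sum, so both are vector functionals in its GNS representation.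
  have hΦ := hψ.add hφ
  let π := hΦ.toPositiveLinearMap.gnsStarAlgHom
  let ξ := gnsVector hΦ.toPositiveLinearMap
  have hξ : ∀ x, (ψ (star x * x) + φ (star x * x)).re = ‖π x ξ‖ ^ 2 := by
    intro x
    have h1 := DFunLike.congr_fun hΦ.eq_vecState_gns (star x * x)
    rw [vecState_star_mul_self, LinearMap.add_apply] at h1
    rw [h1, Complex.ofReal_re]
  obtain ⟨R, -, -, -, hR⟩ := hψ.exists_commutant_of_le π ξ (fun x => by
    rw [← hξ, Complex.add_re]
    have := (Complex.le_def.1 (hφ x)).1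
    simp only [Complex.zero_re] at this
    linarith)
  obtain ⟨R', -, -, -, hR'⟩ := hφ.exists_commutant_of_le π ξ (fun x => by
    rw [← hξ, Complex.add_re]
    have := (Complex.le_def.1 (hψ x)).1
    simp only [Complex.zero_re] at this
    linarith)
  have hζN : R' ξ ∈ normalVec π := by
    rw [mem_normalVec, ← hR']
    exact hφn
  have hinv' : IsInvariant α (vecState π (R ξ)) := hR ▸ hinv
  obtain ⟨x, h0, h1, h2, h3⟩ := exists_small_of_vecState α hfp hf π hζN hinv' hδ
  refine ⟨x, h0, h1, ?_, ?_⟩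
  · rwa [DFunLike.congr_fun hR' (f - x)]
  · rwa [DFunLike.congr_fun hR x]

end InvariantFunctionals

/-! ### Integration over translated sets in a semigroup. -/

section Translation

variable {G : Type*} [MeasurableSpace G]

/-- Because `R '' (R ⁻¹' E ∩ K) = E ∩ R '' K`, invariance of `m` under images gives the pushforward
formula even when `R` is not injective. -/
lemma map_restrict_of_image_eq {m : Measure G} {R : G → G} (hR : Measurable R)
    (hm : ∀ B, MeasurableSet B → m (R '' B) = m B) {K : Set G} (hK : MeasurableSet K) :
    (m.restrict K).map R = m.restrict (R '' K) := by
  ext E hE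
  rw [Measure.map_apply hR hE, Measure.restrict_apply (hR hE), Measure.restrict_apply hE,
    ← hm _ ((hR hE).inter hK), Set.image_preimage_inter]

/-- Translating the domain of integration costs at most twice the measure of the symmetric
difference. -/
lemma norm_setIntegral_comp_sub_le {m : Measure G} {R : G → G} (hR : Measurable R)
    (hm : ∀ B, MeasurableSet B → m (R '' B) = m B) {K : Set G} (hK : MeasurableSet K)
    (hKfin : m K ≠ ∞) {F : G → ℂ} (hF : StronglyMeasurable F) {C : ℝ} (hC : ∀ g, ‖F g‖ ≤ C) :
    ‖∫ g in K, F (R g) ∂m - ∫ g in K, F g ∂m‖ ≤ 2 * C * (m (K ∆ (R '' K))).toReal := by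
  have hRK : m (R '' K) ≠ ∞ := by rwa [hm K hK]
  -- The image need not be measurable; its measurable hull induces the same restricted measure.
  set T := toMeasurable m (R '' K) with hT
  have hTm : MeasurableSet T := measurableSet_toMeasurable _ _
  have hTfin : m T ≠ ∞ := by rwa [hT, measure_toMeasurable]
  have hrestr : m.restrict T = m.restrict (R '' K) := Measure.restrict_toMeasurable hRK
  have h1 : ∫ g in K, F (R g) ∂m = ∫ g in T, F g ∂m := by
    rw [hrestr, ← map_restrict_of_image_eq hR hm hK,
      integral_map hR.aemeasurable hF.aestronglyMeasurable]
  have hFint : ∀ {S : Set G}, m S ≠ ∞ → IntegrableOn F S m := fun hS =>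
    Measure.integrableOn_of_bounded hS hF.aestronglyMeasurable (ae_of_all _ hC)
  have h2 := integral_inter_add_sdiff hTm (hFint hKfin)
  have h3 := integral_inter_add_sdiff hK (hFint hTfin)
  have hΔ : m (K ∆ (R '' K)) ≠ ∞ := by
    refine ne_top_of_le_ne_top (ENNReal.add_ne_top.2 ⟨hKfin, hRK⟩) ?_
    exact (measure_mono (Set.union_subset_union Set.sdiff_subset Set.sdiff_subset)).trans
      (measure_union_le _ _)
  have h4 : m (K \ T) ≤ m (K ∆ (R '' K)) :=
    measure_mono fun g hg => Or.inl ⟨hg.1, fun h => hg.2 (subset_toMeasurable _ _ h)⟩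
  have h5 : m (T \ K) ≤ m (K ∆ (R '' K)) := by
    have h6 : m (T \ K) = m ((R '' K) \ K) := by
      have := congrArg (fun μ : Measure G => μ Kᶜ) hrestr
      simp only [Measure.restrict_apply hK.compl] at this
      rw [Set.sdiff_eq, Set.sdiff_eq, Set.inter_comm T, Set.inter_comm (R '' K)]
      exact this
    rw [h6]
    exact measure_mono fun g hg => Or.inr hg
  have hC0 : ∀ g : G, 0 ≤ C := fun g => (norm_nonneg _).trans (hC g)
  have key : ∀ {S : Set G}, m S ≤ m (K ∆ (R '' K)) →
      ‖∫ g in S, F g ∂m‖ ≤ C * (m (K ∆ (R '' K))).toReal := by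
    intro S hS
    have h7 := norm_setIntegral_le_of_norm_le_const (μ := m) (s := S) (f := F) (C := C)
      (hS.trans_lt hΔ.lt_top) (fun g _ => hC g)
    -- A point of `G` is needed to know that `0 ≤ C`.
    rcases isEmpty_or_nonempty G with hG | ⟨⟨g⟩⟩
    · have : ∀ S : Set G, m S = 0 := fun S => by rw [Set.eq_empty_of_isEmpty S, measure_empty]
      simp [this]
    · refine h7.trans (mul_le_mul_of_nonneg_left ?_ (hC0 g))
      exact ENNReal.toReal_mono hΔ hS
  have h8 : ∫ g in K, F (R g) ∂m - ∫ g in K, F g ∂m =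
      ∫ g in T \ K, F g ∂m - ∫ g in K \ T, F g ∂m := by
    rw [h1, ← h2, ← h3, Set.inter_comm T K]
    ring
  rw [h8]
  refine (norm_sub_le _ _).trans ?_
  linarith [key h4, key h5]

end Translation

/-! ### Ergodic averages: positivity, contractivity, asymptotic invariance. -/

section Average

variable {H : Type*} [NormedAddCommGroup H] [InnerProductSpace ℂ H] [CompleteSpace H]
variable {M : VonNeumannAlgebra H} {G : Type*} [Semigroup G] [TopologicalSpace G]
variable [MeasurableSpace G] [BorelSpace G]

lemma average_spec (α : DynSystem M G) (m : Measure G) (K : Set G) (x : Elem M) :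
    IsAverage α m K x (average α m K x) := (exists_isAverage α m K x).choose_spec

lemma inner_average (α : DynSystem M G) (m : Measure G) (K : Set G) (x : Elem M) (w v : H) :
    ⟪w, (average α m K x : H →L[ℂ] H) v⟫_ℂ =
      ((m K).toReal : ℂ)⁻¹ * ∫ g in K, ⟪w, (α.act g x : H →L[ℂ] H) v⟫_ℂ ∂m :=
  average_spec α m K x _ (isNormal_vecFun w v)

lemma elem_ext_inner {x y : Elem M}
    (h : ∀ w v : H, ⟪w, (x : H →L[ℂ] H) v⟫_ℂ = ⟪w, (y : H →L[ℂ] H) v⟫_ℂ) : x = y := by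
  apply Subtype.ext
  ext v
  exact ext_inner_left ℂ fun w => h w v

lemma norm_elem_le_of_inner {x : Elem M} {C : ℝ} (hC : 0 ≤ C)
    (h : ∀ w v : H, ‖⟪w, (x : H →L[ℂ] H) v⟫_ℂ‖ ≤ C * (‖w‖ * ‖v‖)) : ‖x‖ ≤ C := by
  change ‖(x : H →L[ℂ] H)‖ ≤ C
  refine ContinuousLinearMap.opNorm_le_bound _ hC fun v => ?_
  have h1 := h ((x : H →L[ℂ] H) v) v
  rw [inner_self_eq_norm_sq_to_K] at h1
  have h2 : ‖(x : H →L[ℂ] H) v‖ ^ 2 ≤ C * (‖(x : H →L[ℂ] H) v‖ * ‖v‖) := by simpa using h1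
  rcases (norm_nonneg ((x : H →L[ℂ] H) v)).eq_or_lt with h0 | h0
  · rw [← h0]
    positivity
  · refine le_of_mul_le_mul_left ?_ h0
    linarith

variable (α : DynSystem M G) {m : Measure G} {K : Set G}

lemma average_add (hK : m K ≠ ∞) (x y : Elem M) :
    average α m K (x + y) = average α m K x + average α m K y := by
  refine elem_ext_inner fun w v => ?_
  change _ = ⟪w, (average α m K x : H →L[ℂ] H) v + (average α m K y : H →L[ℂ] H) v⟫_ℂ
  rw [inner_add_right, inner_average, inner_average, inner_average, ← mul_add,
    ← integral_add (integrableOn_inner α hK x w v) (integrableOn_inner α hK y w v)]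
  congr 1
  apply integral_congr_ae
  filter_upwards with g
  simp only [map_add]
  rw [← inner_add_right]
  rfl

lemma average_smul (c : ℂ) (x : Elem M) :
    average α m K (c • x) = c • average α m K x := by
  refine elem_ext_inner fun w v => ?_
  change _ = ⟪w, c • (average α m K x : H →L[ℂ] H) v⟫_ℂ
  rw [inner_smul_right, inner_average, inner_average, mul_left_comm, ← integral_const_mul c]
  congr 1
  apply integral_congr_ae
  filter_upwards with g
  simp only [map_smul]
  rw [← inner_smul_right]
  rfl

/-- The averaging operator as a linear map. -/
def averageₗ (m : Measure G) (K : Set G) (hK : m K ≠ ∞) : Elem M →ₗ[ℂ] Elem M where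
  toFun := average α m K
  map_add' := average_add α hK
  map_smul' := average_smul α

lemma average_sub (hK : m K ≠ ∞) (x y : Elem M) :
    average α m K (x - y) = average α m K x - average α m K y :=
  map_sub (averageₗ α m K hK) x y

lemma elem_nonneg_iff_inner {x : Elem M} :
    0 ≤ x ↔ ∀ v : H, 0 ≤ ⟪v, (x : H →L[ℂ] H) v⟫_ℂ := by
  change (0 : H →L[ℂ] H) ≤ x ↔ _
  rw [ContinuousLinearMap.nonneg_iff_isPositive]
  refine ⟨fun h v => h.inner_nonneg_right v, fun h => ?_⟩
  rw [ContinuousLinearMap.isPositive_iff_complex]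
  intro v
  have h1 := h v
  have h2 : ⟪(x : H →L[ℂ] H) v, v⟫_ℂ = ⟪v, (x : H →L[ℂ] H) v⟫_ℂ := by
    rw [← inner_conj_symm]
    exact Complex.conj_eq_iff_im.2 (Complex.le_def.1 h1).2.symm
  rw [h2]
  exact ⟨Complex.conj_eq_iff_re.1 (Complex.conj_eq_iff_im.2 (Complex.le_def.1 h1).2.symm),
    (Complex.le_def.1 h1).1⟩

lemma average_nonneg {x : Elem M} (hx : 0 ≤ x) : 0 ≤ average α m K x := by
  rw [elem_nonneg_iff_inner]
  intro v
  rw [inner_average]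
  refine mul_nonneg (inv_nonneg_of_nonneg (Complex.zero_le_real.2 ENNReal.toReal_nonneg)) ?_
  exact integral_nonneg fun g => elem_nonneg_iff_inner.1 (α.act_nonneg g x hx) v

lemma average_mono (hK : m K ≠ ∞) {x y : Elem M} (h : x ≤ y) :
    average α m K x ≤ average α m K y := by
  have := average_nonneg α (m := m) (K := K) (sub_nonneg.2 h)
  rwa [average_sub α hK, sub_nonneg] at this

lemma norm_average_le (hK : m K ≠ ∞) (x : Elem M) : ‖average α m K x‖ ≤ ‖x‖ := by
  refine norm_elem_le_of_inner (norm_nonneg _) fun w v => ?_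
  rw [inner_average, norm_mul, norm_inv, Complex.norm_real, Real.norm_of_nonneg
    ENNReal.toReal_nonneg]
  have h1 := norm_setIntegral_le_of_norm_le_const (μ := m) (s := K) (C := ‖w‖ * (‖x‖ * ‖v‖))
    hK.lt_top (fun g _ => norm_inner_act_le α g x w v)
  rcases eq_or_ne (m K).toReal 0 with h0 | h0
  · rw [h0, inv_zero, zero_mul]
    positivity
  · have h2 : 0 < (m K).toReal := lt_of_le_of_ne ENNReal.toReal_nonneg h0.symm
    rw [inv_mul_le_iff₀ h2]
    refine h1.trans_eq ?_
    simp only [Measure.real]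
    ring

/-- Invariant normal functionals are invariant under averaging. -/
lemma apply_average {ν : Elem M →ₗ[ℂ] ℂ} (hn : IsNormal ν) (hinv : IsInvariant α ν)
    (hK0 : m K ≠ 0) (hK : m K ≠ ∞) (x : Elem M) : ν (average α m K x) = ν x := by
  rw [average_spec α m K x ν hn]
  simp only [hinv _ x, integral_const, measureReal_restrict_apply_univ]
  have h0 : (m K).toReal ≠ 0 := ENNReal.toReal_ne_zero.2 ⟨hK0, hK⟩
  rw [Complex.real_smul, ← mul_assoc, Measure.real, inv_mul_cancel₀, one_mul]
  exact_mod_cast h0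

/-- `R` stands for right translation by `g` in the case of an action and left translation in the
case of an anti-action; `hact` is what the two cases share. -/
lemma norm_average_translate_le (hK : MeasurableSet K) (hKfin : m K ≠ ∞) {R : G → G}
    (hR : Measurable R) (hm : ∀ B, MeasurableSet B → m (R '' B) = m B) {g : G}
    (hact : ∀ h, ∀ x : Elem M, α.act h (α.act g x) = α.act (R h) x) (x : Elem M) :
    ‖average α m K (α.act g x - x)‖ ≤ 2 * ‖x‖ * (m (K ∆ (R '' K)) / m K).toReal := by
  rw [average_sub α hKfin]
  refine norm_elem_le_of_inner (by positivity) fun w v => ?_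
  change ‖⟪w, (average α m K (α.act g x) : H →L[ℂ] H) v - (average α m K x : H →L[ℂ] H) v⟫_ℂ‖ ≤ _
  rw [inner_sub_right, inner_average, inner_average, ← mul_sub, norm_mul, norm_inv,
    Complex.norm_real, Real.norm_of_nonneg ENNReal.toReal_nonneg, ENNReal.toReal_div]
  simp only [hact]
  have h1 := norm_setIntegral_comp_sub_le hR hm hK hKfin
    (α.continuous_act x _ (isNormal_vecFun w v)).stronglyMeasurable
    (fun g => norm_inner_act_le α g x w v)
  calc _ ≤ ((m K).toReal)⁻¹ * (2 * (‖w‖ * (‖x‖ * ‖v‖)) * (m (K ∆ (R '' K))).toReal) := by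
        gcongr
        exact h1
    _ = _ := by
        rw [div_eq_mul_inv]
        ring

/-- Averages over a Følner sequence are asymptotically invariant. -/
theorem tendsto_average_act_sub [ContinuousMul G] (hm : IsBiinvariant m) {K : ℕ → Set G} (hK : IsFolnerSeq m K)
    (g : G) (x : Elem M) :
    Tendsto (fun n => ‖average α m (K n) (α.act g x - x)‖) atTop (𝓝 0) := by
  have main : ∀ R : G → G, Measurable R → (∀ B, MeasurableSet B → m (R '' B) = m B) →
      (∀ h, ∀ x : Elem M, α.act h (α.act g x) = α.act (R h) x) →
      Tendsto (fun n => m (K n ∆ (R '' K n)) / m (K n)) atTop (𝓝 0) →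
      Tendsto (fun n => ‖average α m (K n) (α.act g x - x)‖) atTop (𝓝 0) := by
    intro R hR hRm hact hlim
    have h1 : Tendsto (fun n => 2 * ‖x‖ * (m (K n ∆ (R '' K n)) / m (K n)).toReal) atTop
        (𝓝 0) := by
      have := ((ENNReal.tendsto_toReal ENNReal.zero_ne_top).comp hlim).const_mul (2 * ‖x‖)
      simpa using this
    exact squeeze_zero (fun n => norm_nonneg _) (fun n => norm_average_translate_le α
      (hK.measurableSet n) (hK.lt_top n).ne hR hRm hact x) h1
  rcases α.act_mul with h | h
  · refine main (fun h => h * g) (continuous_mul_const g).measurable (fun B hB => (hm g B hB).2)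
      (fun k x => ?_) (hK.right g)
    rw [h k g]
    rfl
  · refine main (fun h => g * h) (continuous_const_mul g).measurable (fun B hB => (hm g B hB).1)
      (fun k x => ?_) (hK.left g)
    rw [h g k]
    rfl

end Average

/-! ### Invariant functionals from Hahn-Banach. -/

section Minimax

/-- A linear functional dominated by a family of upper bounds that is additive and positively
homogeneous. -/
lemma exists_linear_le_of_sublinear {E : Type*} [AddCommGroup E] [Module ℝ E] (S : E → Set ℝ)
    (hne : ∀ y, (S y).Nonempty) (hbdd : ∀ y, BddBelow (S y)) (h0 : ∀ s ∈ S 0, 0 ≤ s)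
    (hsmul : ∀ (c : ℝ), 0 < c → ∀ y, ∀ s ∈ S y, c * s ∈ S (c • y))
    (hadd : ∀ y z, ∀ s ∈ S y, ∀ t ∈ S z, s + t ∈ S (y + z)) :
    ∃ g : E →ₗ[ℝ] ℝ, ∀ y, ∀ s ∈ S y, g y ≤ s := by
  -- `y ↦ inf S(y)` is sublinear, and the zero map on the trivial subspace is extended below it.
  obtain ⟨g, -, hg⟩ := exists_extension_of_le_sublinear (⊥ : E →ₗ.[ℝ] ℝ) (fun y => sInf (S y))
    (by
      have hle : ∀ c : ℝ, 0 < c → ∀ y, sInf (S (c • y)) ≤ c * sInf (S y) := by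
        intro c hc y
        rw [← div_le_iff₀' hc]
        refine le_csInf (hne y) fun s hs => ?_
        rw [div_le_iff₀' hc]
        exact csInf_le (hbdd _) (hsmul c hc y s hs)
      intro c hc y
      refine le_antisymm (hle c hc y) ?_
      have h1 := hle c⁻¹ (inv_pos.2 hc) (c • y)
      rw [smul_smul, inv_mul_cancel₀ hc.ne', one_smul, ← div_eq_inv_mul, le_div_iff₀' hc] at h1
      exact h1)
    (by
      intro y z
      rw [← sub_le_iff_le_add]
      refine le_csInf (hne y) fun s hs => ?_
      rw [sub_le_iff_le_add, ← sub_le_iff_le_add']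
      refine le_csInf (hne z) fun t ht => ?_
      rw [sub_le_iff_le_add']
      exact csInf_le (hbdd _) (hadd y z s hs t ht))
    (by
      rintro ⟨x, hx⟩
      have hx0 : x = 0 := (Submodule.mem_bot ℝ).1 hx
      subst hx0
      have h1 : (⊥ : E →ₗ.[ℝ] ℝ) ⟨0, hx⟩ = 0 := map_zero (⊥ : E →ₗ.[ℝ] ℝ).toFun
      rw [h1]
      exact le_csInf (hne 0) h0)
  exact ⟨g, fun y s hs => (hg y).trans (csInf_le (hbdd y) hs)⟩

variable {H : Type*} [NormedAddCommGroup H] [InnerProductSpace ℂ H] [CompleteSpace H]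
variable {M : VonNeumannAlgebra H} {G : Type*} [Semigroup G] [TopologicalSpace G]
variable [MeasurableSpace G] [BorelSpace G]

lemma re_inner_le_norm (x : Elem M) (v : H) :
    (⟪v, (x : H →L[ℂ] H) v⟫_ℂ).re ≤ ‖x‖ * ‖v‖ ^ 2 := by
  refine (Complex.re_le_norm _).trans ((norm_inner_le_norm _ _).trans ?_)
  have h1 : ‖(x : H →L[ℂ] H) v‖ ≤ ‖x‖ * ‖v‖ := (x : H →L[ℂ] H).le_opNorm v
  nlinarith [norm_nonneg v]

/-- The quadratic form of an element of `M`, linear in the element. -/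
def quadForm (v : H) : Elem M →ₗ[ℝ] ℝ where
  toFun x := (⟪v, (x : H →L[ℂ] H) v⟫_ℂ).re
  map_add' x y := by simp
  map_smul' c x := by simp

lemma quadForm_apply (v : H) (x : Elem M) :
    quadForm v x = (⟪v, (x : H →L[ℂ] H) v⟫_ℂ).re := rfl

lemma quadForm_le (v : H) (x : Elem M) : quadForm v x ≤ ‖x‖ * ‖v‖ ^ 2 := re_inner_le_norm x v

lemma quadForm_nonneg (v : H) {x : Elem M} (hx : 0 ≤ x) : 0 ≤ quadForm v x :=
  (Complex.le_def.1 (elem_nonneg_iff_inner.1 hx v)).1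

variable [ContinuousMul G]

/-- If the averages of no element of a convex set are eventually bounded by `β`, then some
invariant positive functional is at least `β` on this set. -/
theorem exists_invariant_functional (α : DynSystem M G) {m : Measure G} (hm : IsBiinvariant m)
    {K : ℕ → Set G} (hK : IsFolnerSeq m K) {C : Set (Elem M)} (hC : Convex ℝ C)
    (hCne : C.Nonempty) {β : ℝ}
    (hβ : ∀ x ∈ C, ¬ ∀ᶠ n in atTop, ∀ v, quadForm v (average α m (K n) x) ≤ β * ‖v‖ ^ 2) :
    ∃ ψ : Elem M →ₗ[ℂ] ℂ, IsPos ψ ∧ IsInvariant α ψ ∧ ∀ x ∈ C, β ≤ (ψ x).re := by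
  let A : ℕ → Elem M →ₗ[ℝ] Elem M := fun n =>
    (averageₗ α m (K n) (hK.lt_top n).ne).restrictScalars ℝ
  have hA : ∀ n x, A n x = average α m (K n) x := fun _ _ => rfl
  -- Eventual upper bounds for the averages of `y`, with `t • x` added at the price `tβ`. Taking `t
  -- = 0` puts `g` below the asymptotic size of the averages, which forces positivity and
  -- invariance; taking `y = -x`, `t = 1`, `s = -β` forces `g x ≥ β` on `C`.
  let S : Elem M → Set ℝ := fun y => {s | ∃ t : ℝ, 0 ≤ t ∧ ∃ x ∈ C, ∀ᶠ n in atTop, ∀ v,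
    quadForm v (A n (y + t • x)) ≤ (s + t * β) * ‖v‖ ^ 2}
  obtain ⟨x₀, hx₀⟩ := hCne
  have hS0 : ∀ {y s}, (∀ᶠ n in atTop, ∀ v, quadForm v (A n y) ≤ s * ‖v‖ ^ 2) → s ∈ S y := by
    intro y s h
    refine ⟨0, le_rfl, x₀, hx₀, ?_⟩
    simpa using h
  -- By `hβ`, infinitely often some vector `v` sees the average of `x` above `β`; there the price
  -- `tβ` is repaid, leaving only the average of `y`.
  have hlow : ∀ y, ∀ s ∈ S y, -‖y‖ ≤ s := by
    rintro y s ⟨t, ht, x, hx, hev⟩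
    have h1 := hβ x hx
    rw [not_eventually] at h1
    obtain ⟨n, hn, hn'⟩ := (h1.and_eventually hev).exists
    push Not at hn
    obtain ⟨v, hv⟩ := hn
    have h2 := hn' v
    rw [map_add, map_add, map_smul, map_smul, smul_eq_mul, hA n x] at h2
    have h3 : -(‖y‖ * ‖v‖ ^ 2) ≤ quadForm v (A n y) := by
      have h4 := quadForm_le v (A n (-y))
      rw [map_neg, map_neg] at h4
      have h5 : ‖-(A n y)‖ ≤ ‖y‖ := by
        rw [norm_neg]
        exact norm_average_le α (hK.lt_top n).ne y
      nlinarith [sq_nonneg ‖v‖]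
    have h6 : t * (β * ‖v‖ ^ 2) ≤ t * quadForm v (average α m (K n) x) :=
      mul_le_mul_of_nonneg_left hv.le ht
    have h7 : 0 < ‖v‖ ^ 2 := by
      rcases (sq_nonneg ‖v‖).eq_or_lt with h0 | h0
      · have hv0 : v = 0 := by simpa using h0.symm
        subst hv0
        simp [quadForm_apply] at hv
      · exact h0
    have h8 : -‖y‖ * ‖v‖ ^ 2 ≤ s * ‖v‖ ^ 2 := by linarith
    exact le_of_mul_le_mul_right h8 h7
  obtain ⟨g, hg⟩ := exists_linear_le_of_sublinear S
    (fun y => ⟨‖y‖, hS0 (Eventually.of_forall fun n v => (quadForm_le v _).trans (by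
      gcongr
      exact norm_average_le α (hK.lt_top n).ne y))⟩)
    (fun y => ⟨-‖y‖, fun s hs => hlow y s hs⟩)
    (fun s hs => by simpa using hlow 0 s hs)
    (by
      rintro c hc y s ⟨t, ht, x, hx, hev⟩
      refine ⟨c * t, by positivity, x, hx, hev.mono fun n hn v => ?_⟩
      rw [← smul_smul, ← smul_add, map_smul, map_smul, smul_eq_mul]
      calc c * quadForm v (A n (y + t • x)) ≤ c * ((s + t * β) * ‖v‖ ^ 2) := by
            gcongr
            exact hn v
        _ = _ := by ring)
    (by
      rintro y z s ⟨t, ht, x, hx, hev⟩ s' ⟨t', ht', x', hx', hev'⟩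
      -- Convexity of `C` merges the two correction terms into one.
      obtain ⟨w, hw, hww⟩ : ∃ w ∈ C, (t + t') • w = t • x + t' • x' := by
        rcases (add_nonneg ht ht').eq_or_lt with h0 | h0
        · have h1 : t = 0 := by linarith
          have h2 : t' = 0 := by linarith
          exact ⟨x, hx, by simp [h1, h2]⟩
        · refine ⟨(t / (t + t')) • x + (t' / (t + t')) • x',
            hC hx hx' (by positivity) (by positivity) (by field_simp), ?_⟩
          rw [smul_add, smul_smul, smul_smul, mul_div_cancel₀ _ h0.ne', mul_div_cancel₀ _ h0.ne']
      refine ⟨t + t', by positivity, w, hw, (hev.and hev').mono fun n hn v => ?_⟩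
      rw [hww, show y + z + (t • x + t' • x') = (y + t • x) + (z + t' • x') by abel, map_add,
        map_add]
      linarith [hn.1 v, hn.2 v])
  have hpos : ∀ x, 0 ≤ x → 0 ≤ g x := by
    intro x hx
    have h1 := hg (-x) 0 (hS0 (Eventually.of_forall fun n v => by
      rw [map_neg, map_neg, zero_mul, neg_nonpos]
      exact quadForm_nonneg v (average_nonneg α hx)))
    rw [map_neg] at h1
    linarith
  -- With this, the complexification `g x - i g(ix)` is real, and equal to `g`, on positive
  -- elements.
  have himag : ∀ x, 0 ≤ x → g (Complex.I • x) = 0 := by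
    intro x hx
    have h1 : ∀ n v, quadForm v (A n (Complex.I • x)) = 0 := by
      intro n v
      have h2 : A n (Complex.I • x) = Complex.I • average α m (K n) x := average_smul α _ _
      have h3 := elem_nonneg_iff_inner.1 (average_nonneg α (m := m) (K := K n) hx) v
      rw [h2, quadForm_apply]
      change (⟪v, Complex.I • (average α m (K n) x : H →L[ℂ] H) v⟫_ℂ).re = 0
      rw [inner_smul_right, Complex.I_mul_re, ← (Complex.le_def.1 h3).2]
      simp
    have h4 := hg (Complex.I • x) 0 (hS0 (Eventually.of_forall fun n v => by simp [h1]))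
    have h5 := hg (-(Complex.I • x)) 0 (hS0 (Eventually.of_forall fun n v => by
      rw [map_neg, map_neg, h1]
      simp))
    rw [map_neg] at h5
    linarith
  have hinv : ∀ a x, g (α.act a x) = g x := by
    intro a x
    have hlim := tendsto_average_act_sub α hm hK a x
    have h1 : ∀ s > 0, g (α.act a x - x) ≤ s ∧ g (-(α.act a x - x)) ≤ s := by
      intro s hs
      have hev := hlim.eventually_lt_const hs
      refine ⟨hg _ s (hS0 (hev.mono fun n hn v => ?_)), hg _ s (hS0 (hev.mono fun n hn v => ?_))⟩
      · refine (quadForm_le v _).trans ?_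
        gcongr
        exact hn.le
      · refine (quadForm_le v _).trans ?_
        rw [map_neg, norm_neg]
        gcongr
        exact hn.le
    have h2 : g (α.act a x - x) ≤ 0 := le_of_forall_pos_le_add fun s hs => by
      simpa using (h1 s hs).1
    have h3 : g (-(α.act a x - x)) ≤ 0 := le_of_forall_pos_le_add fun s hs => by
      simpa using (h1 s hs).2
    rw [map_neg] at h3
    rw [map_sub] at h2 h3
    linarith
  let ψ : Elem M →ₗ[ℂ] ℂ := Module.Dual.extendRCLike (𝕜 := ℂ) g
  have hψ : ∀ x, ψ x = (g x : ℂ) - Complex.I * (g (Complex.I • x) : ℂ) :=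
    Module.Dual.extendRCLike_apply g
  refine ⟨ψ, fun x => ?_, fun a x => ?_, fun x hx => ?_⟩
  · rw [hψ, himag _ (star_mul_self_nonneg x)]
    simpa using hpos _ (star_mul_self_nonneg x)
  · rw [hψ, hψ, hinv, ← map_smul, hinv]
  · have h1 : (ψ x).re = g x := by rw [hψ]; simp
    have h2 := hg (-x) (-β) ⟨1, zero_le_one, x, hx, Eventually.of_forall fun n v => by simp⟩
    rw [map_neg] at h2
    rw [h1]
    linarith

end Minimax

/-! ### The operator monotone function `t ↦ t / (1 + t)`. -/

section Saturation

variable {A : Type*} [CStarAlgebra A] [PartialOrder A] [StarOrderedRing A]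

/-- The operator monotone function `a ↦ a (1 + a)⁻¹` on positive elements. -/
def saturate (a : A) : A := cfcₙ (fun t : ℝ => 1 - (1 + t)⁻¹) a

lemma continuousOn_one_add_inv : ContinuousOn (fun t : ℝ => (1 + t)⁻¹) (Set.Ici 0) :=
  ContinuousOn.inv₀ (by fun_prop) fun t (ht : 0 ≤ t) => by positivity

lemma saturate_eq_cfc {a : A} (ha : 0 ≤ a) :
    saturate a = cfc (fun t : ℝ => 1 - (1 + t)⁻¹) a := by
  refine cfcₙ_eq_cfc ?_ (by norm_num)
  refine (continuousOn_const.sub continuousOn_one_add_inv).mono fun t ht => ?_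
  exact quasispectrum_nonneg_of_nonneg a ha t ht

lemma saturate_mono {a b : A} (ha : 0 ≤ a) (hab : a ≤ b) : saturate a ≤ saturate b :=
  CFC.monotoneOn_one_sub_one_add_inv_real ha (ha.trans hab) hab

lemma spectrum_subset_Ici {a : A} (ha : 0 ≤ a) : spectrum ℝ a ⊆ Set.Ici 0 :=
  fun _ ht => spectrum_nonneg_of_nonneg ha ht

lemma saturate_nonneg {a : A} (ha : 0 ≤ a) : 0 ≤ saturate a := by
  rw [saturate_eq_cfc ha]
  refine cfc_nonneg fun t ht => ?_
  have h0 : 0 ≤ t := spectrum_subset_Ici ha ht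
  rw [sub_nonneg]
  exact inv_le_one_of_one_le₀ (by linarith)

lemma saturate_le_one {a : A} (ha : 0 ≤ a) : saturate a ≤ 1 := by
  rw [saturate_eq_cfc ha]
  refine cfc_le_one _ _ fun t ht => ?_
  have h0 : 0 ≤ t := spectrum_subset_Ici ha ht
  have : 0 ≤ (1 + t)⁻¹ := by positivity
  linarith

lemma saturate_le_self {a : A} (ha : 0 ≤ a) : saturate a ≤ a := by
  rw [saturate_eq_cfc ha]
  conv_rhs => rw [← cfc_id' ℝ a]
  refine cfc_mono (fun t ht => ?_)
    ((continuousOn_const.sub continuousOn_one_add_inv).mono (spectrum_subset_Ici ha)) (by fun_prop)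
  have h0 : 0 ≤ t := spectrum_subset_Ici ha ht
  have h1 : 0 < 1 + t := by positivity
  rw [sub_le_iff_le_add, ← sub_le_iff_le_add', ← one_div, le_div_iff₀ h1]
  nlinarith

lemma saturate_eq_mul {a : A} (ha : 0 ≤ a) :
    saturate a = a * cfc (fun t : ℝ => (1 + t)⁻¹) a ∧
      saturate a = cfc (fun t : ℝ => (1 + t)⁻¹) a * a := by
  have hc : ContinuousOn (fun t : ℝ => (1 + t)⁻¹) (spectrum ℝ a) :=
    continuousOn_one_add_inv.mono (spectrum_subset_Ici ha)
  have hid : cfc (fun t : ℝ => t) a = a := cfc_id' ℝ a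
  have h1 := cfc_mul (fun t : ℝ => t) (fun t : ℝ => (1 + t)⁻¹) a (by fun_prop) hc
  have h2 := cfc_mul (fun t : ℝ => (1 + t)⁻¹) (fun t : ℝ => t) a hc (by fun_prop)
  rw [hid] at h1 h2
  rw [saturate_eq_cfc ha, ← h1, ← h2]
  constructor <;>
  · refine cfc_congr fun t ht => ?_
    have h0 : 0 ≤ t := spectrum_subset_Ici ha ht
    have h3 : 1 + t ≠ 0 := by positivity
    field_simp
    ring

lemma saturate_le_projection {a f : A} (ha : 0 ≤ a) (hf : IsStarProjection f) (hfa : f * a = a) :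
    saturate a ≤ f := by
  have hff : f * f = f := hf.isIdempotentElem
  have hsf : star f = f := hf.isSelfAdjoint
  have haf : a * f = a := by
    have := congrArg star hfa
    rwa [star_mul, hsf, ha.isSelfAdjoint.star_eq] at this
  have h1 : f * saturate a = saturate a := by
    rw [(saturate_eq_mul ha).1, ← mul_assoc, hfa]
  have h2 : saturate a * f = saturate a := by
    rw [(saturate_eq_mul ha).2, mul_assoc, haf]
  have h3 := star_left_conjugate_le_conjugate (saturate_le_one ha) f
  rwa [hsf, h1, h2, mul_one, hff] at h3

/-- For large `c`, the saturation of `c • y` almost dominates `y`. The error `(1 + c)⁻¹` is exact at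
`t = 1`, as the factor `1 - t` in the scalar difference shows. -/
lemma sub_le_saturate_smul {y : A} (hy0 : 0 ≤ y) (hy1 : y ≤ 1) {c : ℝ} (hc : 0 ≤ c) :
    y - (1 + c)⁻¹ • (1 : A) ≤ saturate (c • y) := by
  have hcy : 0 ≤ c • y := smul_nonneg hc hy0
  have hcont : ContinuousOn (fun t : ℝ => 1 - (1 + c * t)⁻¹) (spectrum ℝ y) := by
    refine continuousOn_const.sub (ContinuousOn.inv₀ (by fun_prop) fun t ht => ?_)
    have h0 : 0 ≤ t := spectrum_subset_Ici hy0 ht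
    positivity
  have h1 : saturate (c • y) = cfc (fun t : ℝ => 1 - (1 + c * t)⁻¹) y := by
    rw [saturate_eq_cfc hcy]
    refine (cfc_comp_const_mul c (fun t : ℝ => 1 - (1 + t)⁻¹) y ?_).symm
    refine (continuousOn_const.sub continuousOn_one_add_inv).mono ?_
    rintro _ ⟨t, ht, rfl⟩
    have h0 : 0 ≤ t := spectrum_subset_Ici hy0 ht
    exact mul_nonneg hc h0
  have h2 : y - (1 + c)⁻¹ • (1 : A) = cfc (fun t : ℝ => t - (1 + c)⁻¹) y := by
    rw [cfc_sub (fun t : ℝ => t) (fun _ => (1 + c)⁻¹) y (by fun_prop) (by fun_prop), cfc_id' ℝ y,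
      cfc_const _ y, Algebra.algebraMap_eq_smul_one]
  rw [h1, h2]
  refine cfc_mono (fun t ht => ?_) (by fun_prop) hcont
  have h0 : 0 ≤ t := spectrum_subset_Ici hy0 ht
  have ht1 : t ≤ 1 := by
    have h3 : ‖y‖ ≤ 1 := (CStarAlgebra.norm_le_one_iff_of_nonneg y hy0).2 hy1
    have h4 := spectrum.norm_le_norm_mul_of_mem ht
    have h5 : ‖(1 : A)‖ ≤ 1 := (CStarAlgebra.norm_le_one_iff_of_nonneg 1 zero_le_one).2 le_rfl
    have h6 : t ≤ ‖t‖ := Real.le_norm_self t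
    nlinarith [norm_nonneg y, norm_nonneg (1 : A)]
  have h7 : 0 < 1 + c := by positivity
  have h8 : 0 < 1 + c * t := by positivity
  have h9 : 1 - (1 + c * t)⁻¹ - (t - (1 + c)⁻¹) =
      (1 - t) * (c * t * (1 + c) + 1) / ((1 + c) * (1 + c * t)) := by
    field_simp
    ring
  have h10 : 0 ≤ (1 - t) * (c * t * (1 + c) + 1) / ((1 + c) * (1 + c * t)) := by
    have : 0 ≤ 1 - t := by linarith
    positivity
  linarith

end Saturation

/-! ### Ultraweak limits of bounded sequences. -/

section WeakLimit

variable {H : Type*} [NormedAddCommGroup H] [InnerProductSpace ℂ H] [CompleteSpace H]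
variable {M : VonNeumannAlgebra H}

lemma exists_tendsto_of_bounded (𝒰 : Ultrafilter ℕ) {z : ℕ → ℂ} {C : ℝ} (hz : ∀ n, ‖z n‖ ≤ C) :
    ∃ l, ‖l‖ ≤ C ∧ Tendsto z 𝒰 (𝓝 l) := by
  obtain ⟨l, hl, h⟩ := (isCompact_closedBall (0 : ℂ) C).ultrafilter_le_nhds (𝒰.map z) (by
    rw [le_principal_iff]
    exact Eventually.of_forall (f := (𝒰 : Filter ℕ)) fun n => by simpa using hz n)
  exact ⟨l, by simpa using hl, h⟩

/-- Bounded sequences in a von Neumann algebra have ultraweak limits along ultrafilters. -/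
theorem exists_weakLimit (𝒰 : Ultrafilter ℕ) {x : ℕ → Elem M} {C : ℝ} (hx : ∀ n, ‖x n‖ ≤ C) :
    ∃ y : Elem M, ∀ ν : Elem M →ₗ[ℂ] ℂ, IsNormal ν →
      Tendsto (fun n => ν (x n)) 𝒰 (𝓝 (ν y)) := by
  have hbound : ∀ w v n, ‖⟪w, (x n : H →L[ℂ] H) v⟫_ℂ‖ ≤ C * (‖v‖ * ‖w‖) := by
    intro w v n
    refine (norm_inner_le_norm _ _).trans ?_
    have h1 : ‖(x n : H →L[ℂ] H) v‖ ≤ ‖x n‖ * ‖v‖ := (x n : H →L[ℂ] H).le_opNorm v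
    have h2 := mul_le_mul_of_nonneg_right (hx n) (norm_nonneg v)
    nlinarith [norm_nonneg w]
  choose l hlC hl using fun w v => exists_tendsto_of_bounded 𝒰 (hbound w v)
  let B : H →L⋆[ℂ] H →L[ℂ] ℂ := LinearMap.mkContinuous₂
    (LinearMap.mk₂'ₛₗ (starRingEnd ℂ) (RingHom.id ℂ) (fun v w => star (l w v))
      (by
        intro v v' w
        rw [← star_add]
        congr 1
        refine tendsto_nhds_unique (hl w (v + v')) ?_
        simpa only [map_add, inner_add_right] using (hl w v).add (hl w v'))
      (by
        intro a v w
        rw [smul_eq_mul, mul_comm, show starRingEnd ℂ a = star a from rfl, ← star_mul]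
        congr 1
        refine tendsto_nhds_unique (hl w (a • v)) ?_
        simpa only [map_smul, inner_smul_right] using (hl w v).const_mul a)
      (by
        intro v w w'
        rw [← star_add]
        congr 1
        refine tendsto_nhds_unique (hl (w + w') v) ?_
        simpa only [inner_add_left] using (hl w v).add (hl w' v))
      (by
        intro a v w
        rw [RingHom.id_apply, smul_eq_mul, mul_comm]
        nth_rw 2 [← star_star a]
        rw [← star_mul]
        congr 1
        refine tendsto_nhds_unique (hl (a • w) v) ?_
        simp only [inner_smul_left]
        exact (hl w v).const_mul (star a)))
    C (by
      intro v w
      simp only [LinearMap.mk₂'ₛₗ_apply, norm_star]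
      rw [mul_assoc]
      exact hlC w v)
  let y : H →L[ℂ] H := InnerProductSpace.continuousLinearMapOfBilin B
  have hy : ∀ w v, ⟪w, y v⟫_ℂ = l w v := by
    intro w v
    rw [← inner_conj_symm, InnerProductSpace.continuousLinearMapOfBilin_apply]
    simp [B]
  have hmem : y ∈ M := by
    refine mem_of_commute fun z hz => ?_
    ext v
    refine ext_inner_left ℂ fun w => ?_
    change ⟪w, z (y v)⟫_ℂ = ⟪w, y (z v)⟫_ℂ
    rw [← ContinuousLinearMap.adjoint_inner_left, hy, hy]
    refine tendsto_nhds_unique (hl _ v) ((hl w (z v)).congr fun n => ?_)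
    rw [ContinuousLinearMap.adjoint_inner_left]
    exact congrArg _
      (DFunLike.congr_fun (VonNeumannAlgebra.mem_commutant_iff.1 hz _ (x n).2) v)
  refine ⟨⟨y, hmem⟩, ?_⟩
  rintro ν ⟨ξ, η, hξ, hη, hν⟩
  simp only [hν, hy]
  have hsum : Summable fun n => C * (‖η n‖ * ‖ξ n‖) := by
    refine Summable.mul_left C ?_
    refine Summable.of_nonneg_of_le (fun n => by positivity) (fun n => ?_) (hξ.add hη)
    nlinarith [sq_nonneg (‖ξ n‖ - ‖η n‖), sq_nonneg (‖ξ n‖), sq_nonneg (‖η n‖)]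
  -- Convergence of matrix coefficients passes to all normal functionals, since the series is
  -- dominated uniformly in `n`.
  exact tendsto_tsum_of_dominated_convergence hsum (fun k => hl (ξ k) (η k))
    (Eventually.of_forall fun n k => hbound (ξ k) (η k) n)

lemma nonneg_of_weakLimit {𝒰 : Ultrafilter ℕ} {x : ℕ → Elem M} {y : Elem M}
    (hy : ∀ ν : Elem M →ₗ[ℂ] ℂ, IsNormal ν → Tendsto (fun n => ν (x n)) 𝒰 (𝓝 (ν y)))
    (h : ∀ᶠ n in (𝒰 : Filter ℕ), 0 ≤ x n) : 0 ≤ y := by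
  rw [elem_nonneg_iff_inner]
  intro v
  exact ge_of_tendsto (hy _ (isNormal_vecFun v v))
    (h.mono fun n hn => elem_nonneg_iff_inner.1 hn v)

lemma le_of_weakLimit {𝒰 : Ultrafilter ℕ} {x : ℕ → Elem M} {y b : Elem M}
    (hy : ∀ ν : Elem M →ₗ[ℂ] ℂ, IsNormal ν → Tendsto (fun n => ν (x n)) 𝒰 (𝓝 (ν y)))
    (h : ∀ᶠ n in (𝒰 : Filter ℕ), x n ≤ b) : y ≤ b := by
  rw [← sub_nonneg]
  refine nonneg_of_weakLimit (𝒰 := 𝒰) (x := fun n => b - x n) (fun ν hν => ?_)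
    (h.mono fun n hn => sub_nonneg.2 hn)
  simp only [map_sub]
  exact (hy ν hν).const_sub (ν b)

end WeakLimit

/-! ### Construction of weakly wandering operators. -/

section Wandering

variable {H : Type*} [NormedAddCommGroup H] [InnerProductSpace ℂ H] [CompleteSpace H]
variable {M : VonNeumannAlgebra H} {G : Type*} [Semigroup G] [TopologicalSpace G]
variable [MeasurableSpace G] [BorelSpace G]

lemma norm_le_of_quadForm_le {y : Elem M} (hy : 0 ≤ y) {β : ℝ} (hβ : 0 ≤ β)
    (h : ∀ v, quadForm v y ≤ β * ‖v‖ ^ 2) : ‖y‖ ≤ β := by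
  rw [CStarAlgebra.norm_le_iff_le_algebraMap y hβ hy, ← sub_nonneg, elem_nonneg_iff_inner]
  intro v
  have h1 : ⟪v, ((algebraMap ℝ (Elem M) β - y : Elem M) : H →L[ℂ] H) v⟫_ℂ =
      ((β * ‖v‖ ^ 2 : ℝ) : ℂ) - ⟪v, (y : H →L[ℂ] H) v⟫_ℂ := by
    have h2 : ((algebraMap ℝ (Elem M) β - y : Elem M) : H →L[ℂ] H) v =
        (β : ℂ) • v - (y : H →L[ℂ] H) v := by
      rw [Algebra.algebraMap_eq_smul_one]
      rfl
    rw [h2, inner_sub_right, inner_smul_right, inner_self_eq_norm_sq_to_K]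
    push_cast
    rfl
  rw [h1, sub_nonneg, Complex.le_def]
  refine ⟨by rw [Complex.ofReal_re]; exact h v, ?_⟩
  rw [Complex.ofReal_im]
  exact (Complex.le_def.1 (elem_nonneg_iff_inner.1 hy v)).2.symm

variable [ContinuousMul G]

/-- If all normal invariant states vanish on the projection `f`, there are elements of the unit
interval of its corner which are close to `f` and have eventually small averages. -/
theorem exists_small_average (α : DynSystem M G) {m : Measure G} (hm : IsBiinvariant m)
    {K : ℕ → Set G} (hK : IsFolnerSeq m K) {f : Elem M} (hfp : IsStarProjection f)
    (hf : ∀ ν : Elem M →ₗ[ℂ] ℂ, IsNormalState ν → IsInvariant α ν → ν f = 0)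
    {φ : Elem M →ₗ[ℂ] ℂ} (hφ : IsPos φ) (hφn : IsNormal φ) {δ β : ℝ} (hδ : 0 < δ) (hβ : 0 < β) :
    ∃ x : Elem M, 0 ≤ x ∧ x ≤ f ∧ (φ (f - x)).re ≤ δ ∧
      ∀ᶠ n in atTop, ‖average α m (K n) x‖ ≤ β := by
  by_contra! hcon
  let C : Set (Elem M) := {x | 0 ≤ x ∧ x ≤ f ∧ (φ (f - x)).re ≤ δ}
  have hC : Convex ℝ C := by
    rintro x ⟨hx0, hx1, hx2⟩ y ⟨hy0, hy1, hy2⟩ s t hs ht hst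
    have hf' : f = s • f + t • f := by rw [← add_smul, hst, one_smul]
    refine ⟨add_nonneg (smul_nonneg hs hx0) (smul_nonneg ht hy0), ?_, ?_⟩
    · nth_rw 1 [hf']
      gcongr
    · have h1 : f - (s • x + t • y) = s • (f - x) + t • (f - y) := by
        nth_rw 1 [hf']
        simp only [smul_sub]
        abel
      rw [h1, map_add, LinearMap.map_smul_of_tower, LinearMap.map_smul_of_tower, Complex.add_re,
        Complex.real_smul, Complex.real_smul, Complex.re_ofReal_mul, Complex.re_ofReal_mul]
      calc _ ≤ s * δ + t * δ := by gcongr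
        _ = δ := by rw [← add_mul, hst, one_mul]
  have hfC : f ∈ C := ⟨hfp.nonneg, le_rfl, by simpa using hδ.le⟩
  obtain ⟨ψ, hψ, hψinv, hψC⟩ := exists_invariant_functional α hm hK hC ⟨f, hfC⟩ (β := β) (by
    rintro x ⟨hx0, hx1, hx2⟩ hev
    refine hcon x hx0 hx1 hx2 (hev.mono fun n hn => ?_)
    exact not_lt.2 (norm_le_of_quadForm_le (average_nonneg α hx0) hβ.le hn))
  -- This `x` belongs to `C`, where `ψ ≥ β`, yet `ψ x ≤ β / 2`.
  obtain ⟨x, hx0, hx1, hx2, hx3⟩ := exists_small_of_isInvariant α hfp hf hφ hφn hψ hψinv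
    (δ := min δ (β / 2)) (by positivity)
  have h1 := hψC x ⟨hx0, hx1, hx2.trans (min_le_left _ _)⟩
  have h2 := hx3.trans (min_le_right _ _)
  linarith

/-- If all normal invariant states vanish on the projection `f`, and `φ` does not, then the corner
of `f` contains a weakly wandering operator on which `φ` does not vanish. -/
theorem exists_weaklyWandering (α : DynSystem M G) {m : Measure G} (hm : IsBiinvariant m)
    {K : ℕ → Set G} (hK : IsFolnerSeq m K) {f : Elem M} (hfp : IsStarProjection f)
    (hf : ∀ ν : Elem M →ₗ[ℂ] ℂ, IsNormalState ν → IsInvariant α ν → ν f = 0)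
    {φ : Elem M →ₗ[ℂ] ℂ} (hφ : IsPos φ) (hφn : IsNormal φ) (hφf : 0 < (φ f).re) :
    ∃ x : Elem M, IsWeaklyWandering α m K x ∧ x ≤ f ∧ 0 < (φ x).re := by
  set F := (φ f).re
  choose x hx0 hxf hxφ hxA using fun k : ℕ => exists_small_average α hm hK hfp hf hφ hφn
    (δ := F / 4 * (1 / 4) ^ k) (β := (1 / 2) ^ k) (by positivity) (by positivity)
  let y : ℕ → Elem M := fun k => f - x k
  have hy0 : ∀ k, 0 ≤ y k := fun k => sub_nonneg.2 (hxf k)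
  have hyf : ∀ k, y k ≤ f := fun k => sub_le_self _ (hx0 k)
  have hy1 : ∀ k, y k ≤ 1 := fun k => (hyf k).trans hfp.le_one
  have hfy : ∀ k, f * y k = y k := fun k =>
    (hfp.mul_right_and_mul_left_of_nonneg_of_le (hy0 k) (hyf k)).2
  -- The weights `2ᵏ` grow, yet `φ(S N) ≤ ∑ 2ᵏ (F/4) 4⁻ᵏ ≤ F/2`.
  let S : ℕ → Elem M := fun N => ∑ k ∈ Finset.range N, (2 ^ k : ℝ) • y k
  have hterm : ∀ k, 0 ≤ (2 ^ k : ℝ) • y k := fun k => smul_nonneg (by positivity) (hy0 k)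
  have hS0 : ∀ N, 0 ≤ S N := fun N => Finset.sum_nonneg fun k _ => hterm k
  have hSk : ∀ {k N}, k < N → (2 ^ k : ℝ) • y k ≤ S N := fun {k N} hkN =>
    Finset.single_le_sum (f := fun k => (2 ^ k : ℝ) • y k) (fun i _ => hterm i)
      (Finset.mem_range.2 hkN)
  have hfS : ∀ N, f * S N = S N := by
    intro N
    rw [Finset.mul_sum]
    exact Finset.sum_congr rfl fun k _ => by rw [mul_smul_comm, hfy]
  have hSφ : ∀ N, (φ (S N)).re ≤ F / 2 := by
    intro N
    rw [map_sum, Complex.re_sum]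
    have h1 : ∀ k ∈ Finset.range N, (φ ((2 ^ k : ℝ) • y k)).re ≤ F / 4 * (1 / 2) ^ k := by
      intro k _
      rw [LinearMap.map_smul_of_tower, Complex.real_smul, Complex.re_ofReal_mul]
      calc (2 : ℝ) ^ k * (φ (y k)).re ≤ 2 ^ k * (F / 4 * (1 / 4) ^ k) := by
            gcongr
            exact hxφ k
        _ = F / 4 * (2 * (1 / 4)) ^ k := by rw [mul_pow]; ring
        _ = _ := by norm_num
    refine (Finset.sum_le_sum h1).trans ?_
    rw [← Finset.mul_sum]
    have h2 := (summable_geometric_of_lt_one (r := (1 / 2 : ℝ)) (by norm_num)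
      (by norm_num)).sum_le_tsum (Finset.range N) (fun i _ => by positivity)
    rw [tsum_geometric_of_lt_one (by norm_num) (by norm_num)] at h2
    norm_num at h2 ⊢
    nlinarith
  -- A substitute for the infimum of the `x k`. Saturation only decreases `S N`, so `φ(X N) ≥ F/2`.
  let X : ℕ → Elem M := fun N => f - saturate (S N)
  have hX0 : ∀ N, 0 ≤ X N := fun N =>
    sub_nonneg.2 (saturate_le_projection (hS0 N) hfp (hfS N))
  have hXf : ∀ N, X N ≤ f := fun N => sub_le_self _ (saturate_nonneg (hS0 N))
  have hXφ : ∀ N, F / 2 ≤ (φ (X N)).re := by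
    intro N
    have h1 := (Complex.le_def.1 (hφ.mono (saturate_le_self (hS0 N)))).1
    rw [map_sub, Complex.sub_re]
    have h2 := hSφ N
    change F / 2 ≤ F - _
    linarith
  -- Operator monotonicity applied to `2ᵏ y_k ≤ S N`; as `k` grows the error `(1 + 2ᵏ)⁻¹` tends to
  -- zero, and it does not depend on `N`.
  have hXx : ∀ {k N}, k < N → X N ≤ x k + (1 + 2 ^ k : ℝ)⁻¹ • (1 : Elem M) := by
    intro k N hkN
    have h1 := (sub_le_saturate_smul (hy0 k) (hy1 k) (c := 2 ^ k) (by positivity)).trans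
      (saturate_mono (hterm k) (hSk hkN))
    have h2 : X N ≤ f - (y k - (1 + 2 ^ k : ℝ)⁻¹ • (1 : Elem M)) := sub_le_sub_left h1 f
    refine h2.trans_eq ?_
    simp only [y]
    abel
  obtain ⟨z, hz⟩ := exists_weakLimit (hyperfilter ℕ) (x := X) (C := ‖f‖) fun N =>
    CStarAlgebra.norm_le_norm_of_nonneg_of_le (hX0 N) (hXf N)
  have hz0 : 0 ≤ z := nonneg_of_weakLimit hz (Eventually.of_forall hX0)
  have hzf : z ≤ f := le_of_weakLimit hz (Eventually.of_forall hXf)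
  have hzx : ∀ k, z ≤ x k + (1 + 2 ^ k : ℝ)⁻¹ • (1 : Elem M) := by
    intro k
    refine le_of_weakLimit hz (Eventually.filter_mono Nat.hyperfilter_le_atTop ?_)
    exact (eventually_gt_atTop k).mono fun N hN => hXx hN
  refine ⟨z, ⟨hz0, ?_⟩, hzf, ?_⟩
  · have hAz : ∀ k, ∀ᶠ n in atTop, ‖average α m (K n) z‖ ≤ 2 * (1 / 2) ^ k := by
      intro k
      filter_upwards [hxA k] with n hn
      have hKn : m (K n) ≠ ∞ := (hK.lt_top n).ne
      have h1 := average_mono α hKn (hzx k)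
      have h2 := CStarAlgebra.norm_le_norm_of_nonneg_of_le (average_nonneg α hz0) h1
      rw [average_add α hKn] at h2
      have h3 : ‖average α m (K n) ((1 + 2 ^ k : ℝ)⁻¹ • (1 : Elem M))‖ ≤ (1 / 2) ^ k := by
        refine (norm_average_le α hKn _).trans ?_
        rw [norm_smul]
        have h4 : ‖(1 : Elem M)‖ ≤ 1 := ContinuousLinearMap.norm_id_le
        have h5 : ‖(1 + 2 ^ k : ℝ)⁻¹‖ ≤ (1 / 2) ^ k := by
          rw [Real.norm_of_nonneg (by positivity), one_div, inv_pow]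
          exact inv_anti₀ (by positivity) (by linarith)
        exact (mul_le_mul h5 h4 (norm_nonneg _) (by positivity)).trans_eq (mul_one _)
      linarith [norm_add_le (average α m (K n) (x k))
        (average α m (K n) ((1 + 2 ^ k : ℝ)⁻¹ • (1 : Elem M)))]
    rw [Metric.tendsto_nhds]
    intro ε hε
    obtain ⟨k, hk⟩ := exists_pow_lt_of_lt_one (half_pos hε) (show (1 / 2 : ℝ) < 1 by norm_num)
    filter_upwards [hAz k] with n hn
    rw [dist_zero_right, norm_norm]
    linarith
  · have h1 : Tendsto (fun N => (φ (X N)).re) (hyperfilter ℕ) (𝓝 (φ z).re) :=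
      (Complex.continuous_re.tendsto _).comp (hz φ hφn)
    have h2 := ge_of_tendsto' h1 hXφ
    linarith

end Wandering

/-! ### Supports of functionals and operators; greatest projections. -/

section Supports

variable {H : Type*} [NormedAddCommGroup H] [InnerProductSpace ℂ H] [CompleteSpace H]
variable {M : VonNeumannAlgebra H}

/-- The null projection of a positive normal functional. -/
theorem exists_nullProjection {ν : Elem M →ₗ[ℂ] ℂ} (hν : IsPos ν) (hn : IsNormal ν) :
    ∃ r : Elem M, IsStarProjection r ∧ ν r = 0 ∧ ∀ x, 0 ≤ x → ν x = 0 → r * x = x := by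
  obtain ⟨ζ, rfl⟩ := hν.exists_eq_vecState hn
  -- The span of the commutant orbits of the `ζ n`. If `ν(b⋆b) = 0` then `b` kills every `ζ n`,
  -- hence all of `U`, so the complement of its closure is the null projection.
  let U : Submodule ℂ H := Submodule.span ℂ {w | ∃ z ∈ M.commutant, ∃ n, z (ζ n) = w}
  have hU : ∀ z ∈ M.commutant, ∀ v ∈ U, z v ∈ U.topologicalClosure := by
    intro z hz v hv
    refine U.le_topologicalClosure ?_
    have hle : U ≤ U.comap (z : H →ₗ[ℂ] H) := by
      refine Submodule.span_le.2 ?_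
      rintro _ ⟨z', hz', n, rfl⟩
      exact Submodule.subset_span ⟨z * z', mul_mem hz hz', n, rfl⟩
    exact hle hv
  have : CompleteSpace U.topologicalClosure := U.isClosed_topologicalClosure.completeSpace_coe
  let p : Elem M := ⟨U.topologicalClosure.starProjection, starProjection_mem M U hU⟩
  have hp : IsStarProjection p := isStarProjection_coe.1 isStarProjection_starProjection
  have hζU : ∀ n, ζ n ∈ U.topologicalClosure := fun n =>
    U.le_topologicalClosure (Submodule.subset_span ⟨1, one_mem _, n, rfl⟩)
  refine ⟨1 - p, hp.one_sub, ?_, fun x hx hx0 => ?_⟩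
  · have h1 : normalRep M (1 - p) ζ = 0 := by
      ext n
      change ζ n - U.topologicalClosure.starProjection (ζ n) = 0
      rw [Submodule.starProjection_eq_self_iff.2 (hζU n), sub_self]
    rw [vecState_apply, h1, inner_zero_right]
  · obtain ⟨b, rfl⟩ := CStarAlgebra.nonneg_iff_eq_star_mul_self.1 hx
    rw [vecState_star_mul_self] at hx0
    have h1 : normalRep M b ζ = 0 := by
      have : ‖normalRep M b ζ‖ ^ 2 = 0 := by exact_mod_cast hx0
      simpa using this
    have h2 : ∀ n, (b : H →L[ℂ] H) (ζ n) = 0 := fun n => by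
      rw [← normalRep_apply, h1]
      rfl
    have h3 : U.topologicalClosure ≤ ((b : H →L[ℂ] H) : H →ₗ[ℂ] H).ker := by
      refine Submodule.topologicalClosure_minimal _ (Submodule.span_le.2 ?_)
        (ContinuousLinearMap.isClosed_ker (b : H →L[ℂ] H))
      rintro _ ⟨z, hz, n, rfl⟩
      have h4 := DFunLike.congr_fun (VonNeumannAlgebra.mem_commutant_iff.1 hz b b.2) (ζ n)
      change (b : H →L[ℂ] H) (z (ζ n)) = 0
      refine h4.trans ?_
      change z ((b : H →L[ℂ] H) (ζ n)) = 0
      rw [h2, map_zero]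
    have h5 : b * p = 0 := by
      apply Subtype.ext
      ext v
      exact h3 (U.topologicalClosure.starProjection_apply_mem v)
    have h6 : p * star b = 0 := by
      have := congrArg star h5
      rwa [star_mul, hp.isSelfAdjoint.star_eq, star_zero] at this
    rw [sub_mul, one_mul, ← mul_assoc, h6, zero_mul, sub_zero]

lemma isStarProjection_funSupport (ν : Elem M →ₗ[ℂ] ℂ) : IsStarProjection (funSupport ν) :=
  (exists_isLUB_proj {q : Proj M | ν q.1 = 0}).choose.2.one_sub

/-- The supremum defining the support is attained: the null projection is itself null and dominates
every null projection. -/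
lemma apply_one_sub_funSupport {ν : Elem M →ₗ[ℂ] ℂ} (hν : IsPos ν) (hn : IsNormal ν) :
    ν (1 - funSupport ν) = 0 ∧ ∀ x, 0 ≤ x → ν x = 0 → (1 - funSupport ν) * x = x := by
  obtain ⟨r, hr, hr0, hrx⟩ := exists_nullProjection hν hn
  have hlub := (exists_isLUB_proj {q : Proj M | ν q.1 = 0}).choose_spec
  have hlub' : IsLUB {q : Proj M | ν q.1 = 0} ⟨r, hr⟩ := by
    refine ⟨fun q hq => ?_, fun q hq => hq (a := ⟨r, hr⟩) hr0⟩
    exact q.2.le_of_mul_eq_right hr (hrx q.1 q.2.nonneg hq)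
  have h : 1 - funSupport ν = r := by
    rw [funSupport, sub_sub_cancel, hlub.unique hlub']
  rw [h]
  exact ⟨hr0, hrx⟩

lemma isStarProjection_opSupport (x : Elem M) : IsStarProjection (opSupport x) :=
  (exists_isLeast_support x).choose_spec.1.1

lemma opSupport_mul (x : Elem M) : opSupport x * x = x :=
  (exists_isLeast_support x).choose_spec.1.2

lemma opSupport_le {x p : Elem M} (hp : IsStarProjection p) (h : p * x = x) : opSupport x ≤ p :=
  (exists_isLeast_support x).choose_spec.2 ⟨hp, h⟩

lemma mul_eq_of_opSupport_le {x p : Elem M} (hp : IsStarProjection p) (h : opSupport x ≤ p) :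
    p * x = x := by
  rw [← opSupport_mul x, ← mul_assoc,
    ((isStarProjection_opSupport x).le_iff_mul_eq_right hp).1 h]

/-- Compression by `1 - p` kills `y`, hence `x = z⋆z`, hence `z (1 - p)`. -/
lemma opSupport_mono {x y : Elem M} (hx : 0 ≤ x) (hxy : x ≤ y) : opSupport x ≤ opSupport y := by
  set p := opSupport y
  have hp : IsStarProjection p := isStarProjection_opSupport y
  refine opSupport_le hp ?_
  have h1 : star (1 - p) * x * (1 - p) = 0 := by
    refine le_antisymm ?_ (star_left_conjugate_nonneg hx _)
    refine (star_left_conjugate_le_conjugate hxy (1 - p)).trans_eq ?_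
    have h2 : (1 - p) * y = 0 := by rw [sub_mul, one_mul, opSupport_mul, sub_self]
    rw [hp.one_sub.isSelfAdjoint.star_eq, h2, zero_mul]
  obtain ⟨z, rfl⟩ := CStarAlgebra.nonneg_iff_eq_star_mul_self.1 hx
  have h3 : z * (1 - p) = 0 := by
    rw [← CStarRing.star_mul_self_eq_zero_iff, star_mul, ← h1]
    simp only [mul_assoc]
  have h4 : (1 - p) * star z = 0 := by
    have := congrArg star h3
    rwa [star_mul, hp.one_sub.isSelfAdjoint.star_eq, star_zero] at this
  have h5 : (1 - p) * (star z * z) = 0 := by rw [← mul_assoc, h4, zero_mul]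
  rw [sub_mul, one_mul, sub_eq_zero] at h5
  exact h5.symm

/-- In the presence of a faithful state, a countably directed set of projections has a greatest
element. -/
theorem exists_isGreatest_of_countably_directed {φ : Elem M →ₗ[ℂ] ℂ} (hφ : IsPos φ)
    (hφf : IsFaithful φ) {P : Set (Elem M)} (hP : ∀ p ∈ P, IsStarProjection p) (hne : P.Nonempty)
    (hdir : ∀ p : ℕ → Elem M, (∀ k, p k ∈ P) → ∃ q ∈ P, ∀ k, p k ≤ q) :
    ∃ p, IsGreatest P p := by
  have hmono : ∀ {p q : Elem M}, p ≤ q → (φ p).re ≤ (φ q).re := fun h =>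
    (Complex.le_def.1 (hφ.mono h)).1
  let S : Set ℝ := (fun p => (φ p).re) '' P
  have hSne : S.Nonempty := hne.image _
  have hSb : BddAbove S := ⟨(φ 1).re, by
    rintro _ ⟨p, hp, rfl⟩
    exact hmono (hP p hp).le_one⟩
  obtain ⟨u, -, hu, huS⟩ := exists_seq_tendsto_sSup hSne hSb
  choose p hp hpu using huS
  -- `q` maximizes `φ` on `P`. Any bound `s` in `P` of `q` and `r` then has `φ(s - q) = 0`, so
  -- faithfulness gives `s = q`.
  obtain ⟨q, hq, hpq⟩ := hdir p hp
  have hsup : sSup S ≤ (φ q).re := by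
    refine le_of_tendsto' hu fun k => ?_
    rw [← hpu k]
    exact hmono (hpq k)
  refine ⟨q, hq, fun r hr => ?_⟩
  obtain ⟨s, hs, hrs⟩ := hdir (fun k => if k = 0 then q else r) fun k => by
    by_cases h : k = 0 <;> simp [h, hq, hr]
  have hqs : q ≤ s := by simpa using hrs 0
  have hrs' : r ≤ s := by simpa using hrs 1
  have h1 : (φ s).re ≤ (φ q).re := (le_csSup hSb ⟨s, hs, rfl⟩).trans hsup
  have h2 : 0 ≤ φ (s - q) := hφ.map_nonneg (sub_nonneg.2 hqs)
  have h3 : φ (s - q) = 0 := by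
    refine Complex.ext ?_ (Complex.le_def.1 h2).2.symm
    have h4 := (Complex.le_def.1 h2).1
    rw [map_sub, Complex.sub_re] at h4 ⊢
    rw [Complex.zero_re] at h4 ⊢
    linarith
  have h5 := hφf _ (sub_nonneg.2 hqs) h3
  rwa [sub_eq_zero.1 h5] at hrs'

end Supports

/-! ### Countable unions of supports on either side. -/

section Exhaustion

variable {H : Type*} [NormedAddCommGroup H] [InnerProductSpace ℂ H] [CompleteSpace H]
variable {M : VonNeumannAlgebra H} {G : Type*} [Semigroup G] [TopologicalSpace G]

/-- Countably many normal invariant states are dominated in support by one. -/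
theorem exists_invariant_state_support_ge (α : DynSystem M G) {ν : ℕ → Elem M →ₗ[ℂ] ℂ}
    (hν : ∀ k, IsNormalState (ν k)) (hinv : ∀ k, IsInvariant α (ν k)) :
    ∃ ρ : Elem M →ₗ[ℂ] ℂ, IsNormalState ρ ∧ IsInvariant α ρ ∧
      ∀ k, funSupport (ν k) ≤ funSupport ρ := by
  let c : ℕ → ℂ := fun k => ((1 / 2 : ℝ) ^ (k + 1) : ℝ)
  have hc : ∀ k, 0 < c k := fun k => Complex.zero_lt_real.2 (by positivity)
  have hgeom : HasSum (fun k : ℕ => (1 / 2 : ℝ) ^ (k + 1)) 1 := by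
    simpa [pow_succ', div_eq_mul_inv] using hasSum_geometric_two' 1
  have hμ : ∀ k, IsPos (c k • ν k) := fun k x => mul_nonneg (hc k).le ((hν k).nonneg x)
  obtain ⟨ρ, hρ, hρn, hsum⟩ := exists_hasSum_normal (ν := fun k => c k • ν k) hμ
    (fun k => isNormal_smul _ (hν k).normal) (by
      refine hgeom.summable.congr fun k => ?_
      rw [LinearMap.smul_apply, (hν k).map_one, smul_eq_mul, mul_one, Complex.ofReal_re])
  refine ⟨ρ, ⟨⟨hρ, ?_⟩, hρn⟩, fun g x => ?_, fun k => ?_⟩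
  · have h1 : HasSum (fun k => (c k • ν k) 1) (1 : ℝ) := by
      refine (Complex.hasSum_ofReal.2 hgeom).congr_fun ?_
      intro k
      rw [LinearMap.smul_apply, (hν k).map_one, smul_eq_mul, mul_one]
    simpa using (hsum 1).unique h1
  · refine (hsum (α.act g x)).unique ?_
    simpa only [LinearMap.smul_apply, hinv _ g x] using hsum x
  · have hs := isStarProjection_funSupport ρ
    have hk := isStarProjection_funSupport (ν k)
    have h0 := (apply_one_sub_funSupport hρ hρn).1
    have h1 := hsum (1 - funSupport ρ)
    rw [h0] at h1
    -- `ρ` vanishes on its null projection, so every term of the series does.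
    have h2 := (hasSum_zero_iff_of_nonneg fun k =>
      (hμ k).map_nonneg hs.one_sub_nonneg).1 h1
    have h3 : ν k (1 - funSupport ρ) = 0 := by
      have := congrFun h2 k
      rw [LinearMap.smul_apply, smul_eq_mul] at this
      exact (mul_eq_zero.1 this).resolve_left (hc k).ne'
    have h4 := (apply_one_sub_funSupport (hν k).nonneg (hν k).normal).2 _ hs.one_sub_nonneg h3
    have h5 := hs.one_sub.le_of_mul_eq_right hk.one_sub h4
    exact (sub_le_sub_iff_left 1).1 h5

variable [MeasurableSpace G] [BorelSpace G] (α : DynSystem M G) {m : Measure G} {K : ℕ → Set G}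

/-- Normal invariant states vanish on weakly wandering operators. -/
lemma IsWeaklyWandering.apply_eq_zero (hK : IsFolnerSeq m K) {x : Elem M}
    (hx : IsWeaklyWandering α m K x) {ν : Elem M →ₗ[ℂ] ℂ} (hν : IsNormalState ν)
    (hinv : IsInvariant α ν) : ν x = 0 := by
  have h1 : ∀ n, ‖ν x‖ ≤ ‖average α m (K n) x‖ := by
    intro n
    rw [← apply_average α hν.normal hinv (hK.pos n).ne' (hK.lt_top n).ne x]
    have := IsPos.norm_apply_le (ω := ν) hν.nonneg (average α m (K n) x)
    rwa [hν.map_one, Complex.one_re, mul_one] at this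
  exact norm_le_zero_iff.1 (ge_of_tendsto' hx.2 h1)

lemma isWeaklyWandering_zero (hK : IsFolnerSeq m K) : IsWeaklyWandering α m K 0 := by
  refine ⟨le_rfl, ?_⟩
  have : ∀ n, average α m (K n) (0 : Elem M) = 0 := fun n =>
    map_zero (averageₗ α m (K n) (hK.lt_top n).ne)
  simp [this]

/-- Countably many weakly wandering operators are dominated in support by one. -/
theorem exists_weaklyWandering_support_ge (hK : IsFolnerSeq m K) {x : ℕ → Elem M}
    (hx : ∀ k, IsWeaklyWandering α m K (x k)) :
    ∃ y, IsWeaklyWandering α m K y ∧ ∀ k, opSupport (x k) ≤ opSupport y := by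
  -- The weights make `‖z k‖ ≤ 2⁻ᵏ`; the `+ 1` covers `x k = 0`.
  let c : ℕ → ℝ := fun k => (1 / 2) ^ k * (‖x k‖ + 1)⁻¹
  have hc : ∀ k, 0 < c k := fun k => by positivity
  let z : ℕ → Elem M := fun k => c k • x k
  have hz0 : ∀ k, 0 ≤ z k := fun k => smul_nonneg (hc k).le (hx k).1
  have hznorm : ∀ k, ‖z k‖ ≤ (1 / 2) ^ k := by
    intro k
    rw [norm_smul, Real.norm_of_nonneg (hc k).le, mul_assoc]
    refine mul_le_of_le_one_right (by positivity) ?_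
    rw [inv_mul_le_iff₀ (by positivity)]
    linarith
  have hgeom : Summable fun k : ℕ => (1 / 2 : ℝ) ^ k :=
    summable_geometric_of_lt_one (by norm_num) (by norm_num)
  have hzs : Summable z := Summable.of_norm_bounded hgeom hznorm
  have hzk : ∀ k, z k ≤ ∑' k, z k := fun k => hzs.le_tsum k fun j _ => hz0 j
  refine ⟨∑' k, z k, ⟨tsum_nonneg hz0, ?_⟩, fun k => ?_⟩
  · let A : ℕ → Elem M →ₗ[ℂ] Elem M := fun n => averageₗ α m (K n) (hK.lt_top n).ne
    have hA1 : ∀ n y, ‖A n y‖ ≤ ‖y‖ := fun n y => norm_average_le α (hK.lt_top n).ne y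
    have hzlim : ∀ k, Tendsto (fun n => ‖A n (z k)‖) atTop (𝓝 0) := by
      intro k
      have h1 := (hx k).2.const_mul (c k)
      rw [mul_zero] at h1
      refine h1.congr fun n => ?_
      change _ = ‖A n (c k • x k)‖
      rw [LinearMap.map_smul_of_tower, norm_smul, Real.norm_of_nonneg (hc k).le]
      rfl
    -- Averages are contractions, so the tail is small uniformly in `n`, and finitely many terms
    -- tend to zero.
    have hsplit : ∀ N n, ‖A n (∑' k, z k)‖ ≤
        (∑ k ∈ Finset.range N, ‖A n (z k)‖) + ‖∑' k, z (k + N)‖ := by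
      intro N n
      rw [← hzs.sum_add_tsum_nat_add N, map_add, map_sum]
      refine (norm_add_le _ _).trans (add_le_add (norm_sum_le _ _) (hA1 n _))
    rw [Metric.tendsto_nhds]
    intro ε hε
    have htail := (tendsto_sum_nat_add z).norm
    rw [norm_zero] at htail
    obtain ⟨N, hN⟩ := (htail.eventually_lt_const (half_pos hε)).exists
    have hfin : Tendsto (fun n => ∑ k ∈ Finset.range N, ‖A n (z k)‖) atTop (𝓝 0) := by
      simpa using tendsto_finsetSum (Finset.range N) fun k _ => hzlim k
    filter_upwards [hfin.eventually_lt_const (half_pos hε)] with n hn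
    rw [dist_zero_right, norm_norm]
    have := hsplit N n
    change ‖A n (∑' k, z k)‖ < ε
    linarith
  · refine le_trans ?_ (opSupport_mono (hz0 k) (hzk k))
    refine opSupport_le (isStarProjection_opSupport _) ?_
    have h1 := opSupport_mul (z k)
    simp only [z] at h1 ⊢
    rw [mul_smul_comm] at h1
    exact smul_right_injective _ (hc k).ne' h1

end Exhaustion

/-! ### The two implications. -/

section Main

variable {H : Type*} [NormedAddCommGroup H] [InnerProductSpace ℂ H] [CompleteSpace H]
variable {M : VonNeumannAlgebra H} {G : Type*} [Semigroup G] [TopologicalSpace G]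
variable [MeasurableSpace G] [BorelSpace G] [ContinuousMul G]

/-- A projection to which every weakly wandering operator is orthogonal is charged by a normal
invariant state on each of its nonzero subprojections. -/
lemma eq_zero_of_states_vanish (α : DynSystem M G) {m : Measure G} (hm : IsBiinvariant m)
    {K : ℕ → Set G} (hK : IsFolnerSeq m K) {φ : Elem M →ₗ[ℂ] ℂ} (hφ : IsNormalState φ)
    (hφf : IsFaithful φ) {f : Elem M} (hfp : IsStarProjection f)
    (hf : ∀ ν : Elem M →ₗ[ℂ] ℂ, IsNormalState ν → IsInvariant α ν → ν f = 0)
    (hww : ∀ x, IsWeaklyWandering α m K x → f * x = 0) : f = 0 := by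
  by_contra hne
  have hpos : IsPos φ := hφ.nonneg
  have h0 := hpos.map_nonneg hfp.nonneg
  have h1 : 0 < (φ f).re := by
    refine lt_of_le_of_ne (Complex.le_def.1 h0).1 fun h => hne (hφf f hfp.nonneg ?_)
    exact Complex.ext h.symm (Complex.le_def.1 h0).2.symm
  obtain ⟨x, hx, hxf, hxφ⟩ := exists_weaklyWandering α hm hK hfp hf hpos hφ.normal h1
  have h2 : x = 0 := by
    rw [← (hfp.mul_right_and_mul_left_of_nonneg_of_le hx.1 hxf).2, hww x hx]
  simp [h2] at hxφ

/-- Let `s(x₀)` be the greatest support of a weakly wandering operator. The gap `1 - e - s(x₀)` is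
killed by every invariant normal state, whose support lies under `e`. It also annihilates every
weakly wandering `x`, because `s(x₀) x = x = (1 - e) x`. Hence it is zero. -/
theorem exists_weaklyWandering_of_invariant (α : DynSystem M G) {m : Measure G}
    (hm : IsBiinvariant m) {K : ℕ → Set G} (hK : IsFolnerSeq m K) {φ : Elem M →ₗ[ℂ] ℂ}
    (hφ : IsNormalState φ) (hφf : IsFaithful φ) {e : Elem M} (he : IsStarProjection e)
    {ρ : Elem M →ₗ[ℂ] ℂ} (hρ : IsNormalState ρ) (hρinv : IsInvariant α ρ)
    (hρe : funSupport ρ = e)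
    (hmax : ∀ ν : Elem M →ₗ[ℂ] ℂ, IsNormalState ν → IsInvariant α ν → funSupport ν ≤ e) :
    ∃ x₀ : Elem M, IsWeaklyWandering α m K x₀ ∧ opSupport x₀ = 1 - e ∧
      ∀ x : Elem M, IsWeaklyWandering α m K x → opSupport x ≤ 1 - e := by
  have hle : ∀ x, IsWeaklyWandering α m K x → opSupport x ≤ 1 - e := by
    intro x hx
    refine opSupport_le he.one_sub ?_
    have := (apply_one_sub_funSupport hρ.nonneg hρ.normal).2 x hx.1
      (hx.apply_eq_zero α hK hρ hρinv)
    rwa [hρe] at this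
  obtain ⟨p, ⟨x₀, hx₀, rfl⟩, hp⟩ := exists_isGreatest_of_countably_directed hφ.nonneg hφf
    (P := {p | ∃ x, IsWeaklyWandering α m K x ∧ opSupport x = p})
    (by rintro _ ⟨x, -, rfl⟩; exact isStarProjection_opSupport x)
    ⟨_, 0, isWeaklyWandering_zero α hK, rfl⟩
    (by
      intro p hp
      choose x hx hxp using hp
      obtain ⟨y, hy, hxy⟩ := exists_weaklyWandering_support_ge α hK hx
      exact ⟨_, ⟨y, hy, rfl⟩, fun k => hxp k ▸ hxy k⟩)
  refine ⟨x₀, hx₀, ?_, hle⟩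
  have hs := isStarProjection_opSupport x₀
  have hfp := (hs.le_iff_sub he.one_sub).1 (hle x₀ hx₀)
  have hf := eq_zero_of_states_vanish α hm hK hφ hφf hfp (fun ν hν hinv => by
    have hpos : IsPos ν := hν.nonneg
    have h1 := (apply_one_sub_funSupport hpos hν.normal).1
    have h2 : 1 - e - opSupport x₀ ≤ 1 - funSupport ν :=
      (sub_le_self _ hs.nonneg).trans (sub_le_sub_left (hmax ν hν hinv) 1)
    exact le_antisymm ((hpos.mono h2).trans_eq h1) (hpos.map_nonneg hfp.nonneg)) (fun x hx => by
    have h1 := mul_eq_of_opSupport_le hs (hp ⟨x, hx, rfl⟩)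
    rw [sub_mul, h1, mul_eq_of_opSupport_le he.one_sub (hle x hx), sub_self])
  exact (sub_eq_zero.1 hf).symm

/-- Here the gap is `e - s(ρ)` for the greatest support of an invariant normal state; it annihilates
weakly wandering operators because `e` does. -/
theorem exists_invariant_of_weaklyWandering (α : DynSystem M G) {m : Measure G}
    (hm : IsBiinvariant m) {K : ℕ → Set G} (hK : IsFolnerSeq m K) {φ : Elem M →ₗ[ℂ] ℂ}
    (hφ : IsNormalState φ) (hφf : IsFaithful φ) {e : Elem M} (he : IsStarProjection e)
    (he0 : e ≠ 0) {x₀ : Elem M} (hx₀ : IsWeaklyWandering α m K x₀) (hx₀e : opSupport x₀ = 1 - e)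
    (hmax : ∀ x : Elem M, IsWeaklyWandering α m K x → opSupport x ≤ 1 - e) :
    ∃ ρ : Elem M →ₗ[ℂ] ℂ, IsNormalState ρ ∧ IsInvariant α ρ ∧ funSupport ρ = e ∧
      ∀ ν : Elem M →ₗ[ℂ] ℂ, IsNormalState ν → IsInvariant α ν → funSupport ν ≤ e := by
  have hle : ∀ ν : Elem M →ₗ[ℂ] ℂ, IsNormalState ν → IsInvariant α ν → funSupport ν ≤ e := by
    intro ν hν hinv
    have h1 := (apply_one_sub_funSupport hν.nonneg hν.normal).2 x₀ hx₀.1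
      (hx₀.apply_eq_zero α hK hν hinv)
    have h2 := opSupport_le (isStarProjection_funSupport ν).one_sub h1
    rw [hx₀e] at h2
    exact (sub_le_sub_iff_left 1).1 h2
  have hex : ∀ x, IsWeaklyWandering α m K x → e * x = 0 := by
    intro x hx
    have h1 := mul_eq_of_opSupport_le he.one_sub (hmax x hx)
    rwa [sub_mul, one_mul, sub_eq_self] at h1
  obtain ⟨p, ⟨ρ, hρ, hρinv, rfl⟩, hp⟩ := exists_isGreatest_of_countably_directed hφ.nonneg hφf
    (P := {p | ∃ ν : Elem M →ₗ[ℂ] ℂ, IsNormalState ν ∧ IsInvariant α ν ∧ funSupport ν = p})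
    (by rintro _ ⟨ν, -, -, rfl⟩; exact isStarProjection_funSupport ν)
    (by
      -- Without any invariant normal state, `e` itself would satisfy the vanishing condition
      -- vacuously and so be zero.
      by_contra hempty
      refine he0 (eq_zero_of_states_vanish α hm hK hφ hφf he (fun ν hν hinv => ?_) hex)
      exact absurd ⟨_, ν, hν, hinv, rfl⟩ hempty)
    (by
      intro p hp
      choose ν hν hinv hνp using hp
      obtain ⟨ρ, hρ, hρinv, hνρ⟩ := exists_invariant_state_support_ge α hν hinv
      exact ⟨_, ⟨ρ, hρ, hρinv, rfl⟩, fun k => hνp k ▸ hνρ k⟩)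
  refine ⟨ρ, hρ, hρinv, ?_, hle⟩
  have hs := isStarProjection_funSupport ρ
  have hρe := hle ρ hρ hρinv
  have hfp := (hs.le_iff_sub he).1 hρe
  have hf := eq_zero_of_states_vanish α hm hK hφ hφf hfp (fun ν hν hinv => by
    have hpos : IsPos ν := hν.nonneg
    have h1 := (apply_one_sub_funSupport hpos hν.normal).1
    have h2 : e - funSupport ρ ≤ 1 - funSupport ν :=
      sub_le_sub he.le_one (hp ⟨ν, hν, hinv, rfl⟩)
    exact le_antisymm ((hpos.mono h2).trans_eq h1) (hpos.map_nonneg hfp.nonneg)) (fun x hx => by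
    have h1 : (e - funSupport ρ) * e = e - funSupport ρ := by
      rw [sub_mul, he.isIdempotentElem.eq, (hs.le_iff_mul_eq_left he).1 hρe]
    rw [← h1, mul_assoc, hex x hx, mul_zero])
  exact (sub_eq_zero.1 hf).symm

end Main

end NCErgodic

end

theorem theorem3p8
    {H : Type*} [NormedAddCommGroup H] [InnerProductSpace ℂ H] [CompleteSpace H]
    [TopologicalSpace.SeparableSpace H]
    (M : VonNeumannAlgebra H) (hM : NCErgodic.IsSemifinite M)
    {G : Type*} [Semigroup G] [TopologicalSpace G] [ContinuousMul G] [LocallyCompactSpace G]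
    [SecondCountableTopology G] [T2Space G] [MeasurableSpace G] [BorelSpace G]
    (m : MeasureTheory.Measure G) [MeasureTheory.SigmaFinite m] (hm : NCErgodic.IsBiinvariant m)
    (K : ℕ → Set G) (hK : NCErgodic.IsFolnerSeq m K)
    (α : NCErgodic.DynSystem M G)
    (φ : NCErgodic.Elem M →ₗ[ℂ] ℂ) (hφ : NCErgodic.IsNormalState φ)
    (hφf : NCErgodic.IsFaithful φ)
    (e : NCErgodic.Elem M) (he : IsStarProjection e) (he0 : e ≠ 0) :
    (∃ ρ : NCErgodic.Elem M →ₗ[ℂ] ℂ,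
        NCErgodic.IsNormalState ρ ∧ NCErgodic.IsInvariant α ρ ∧ NCErgodic.funSupport ρ = e ∧
        ∀ ν : NCErgodic.Elem M →ₗ[ℂ] ℂ, NCErgodic.IsNormalState ν → NCErgodic.IsInvariant α ν →
          NCErgodic.funSupport ν ≤ e) ↔
    (∃ x₀ : NCErgodic.Elem M,
        NCErgodic.IsWeaklyWandering α m K x₀ ∧ NCErgodic.opSupport x₀ = 1 - e ∧
        ∀ x : NCErgodic.Elem M, NCErgodic.IsWeaklyWandering α m K x →
          NCErgodic.opSupport x ≤ 1 - e) := by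
  constructor
  · rintro ⟨ρ, hρ, hρinv, hρe, hmax⟩
    exact NCErgodic.exists_weaklyWandering_of_invariant α hm hK hφ hφf he hρ hρinv hρe hmax
  · rintro ⟨x₀, hx₀, hx₀e, hmax⟩
    exact NCErgodic.exists_invariant_of_weaklyWandering α hm hK hφ hφf he he0 hx₀ hx₀e hmax
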